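/- Let $m\ge 0$, let $M$ be a compact connected oriented smooth manifold of dimension $m$ without boundary, and let $\mathbb R^{m+1}$ carry the Euclidean metric $\bar g$ and the standard orientation. For a smooth immersion $f:M\to\mathbb R^{m+1}$ let - $g=f^*\bar g$ be the induced metric, and $g^0_2=g^{-1}\otimes g^{-1}$ the product metric on covariant $2$-tensors, $g^0_2(B,C)=\sum g^{ik}g^{jl}B_{ij}C_{kl}$; - $\nu^f$ be the positively oriented unit normal field, i.e. $(\nu^f,Tf.b_1,\dots,Tf.b_m)$ is a positively oriented basis of $\mathbb R^{m+1}$ exactly when $(b_1,\dots,b_m)$ is a positively oriented basis of $T_xM$; - $L^f$ be the Weingarten map, $g(L^fX,Y)=-\bar g(\nabla_X\nu^f,Tf.Y)$, and $\det(L^f)\in C^\infty(M)$ the Gauß curvature; - $C(L)$ be the classical adjoint (adjugate) of an endomorphism $L$, so that $C(L)L=LC(L)=\det(L)\,I$; - $\nabla^2\varphi$ be the second covariant derivative (Hessian) of $\varphi\in C^\infty(M)$ with respect to the Levi-Civita connection of $g$. Let $f_0:M\to\mathbb R^{m+1}$ be a smooth immersion and $h\in C^\infty(M,\mathbb R^{m+1})$.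 Write $h=h^\bot\nu^{f_0}+Tf_0.h^\top$, where $h^\bot=\bar g(h,\nu^{f_0})$ and $h^\top$ is the vector field on $M$ with $g(h^\top,X)=\bar g(h,Tf_0.X)$ for all $X$, $g=f_0^*\bar g$. Then the map $f\mapsto\det(L^f)$ from immersions to $C^\infty(M)$ has at $f_0$ in direction $h$ the first variation $$D_{(f_0,h)}\det(L^f)=\operatorname{Tr}(L^{f_0})\det(L^{f_0})\,h^\bot+g^0_2\big(g.C(L^{f_0}),\nabla^2 h^\bot\big)+d\det(L^{f_0})(h^\top),$$ where $g.C(L)$ is the $2$-tensor $(X,Y)\mapsto g(C(L)X,Y)$. That is: there are smooth paths of immersions $f:\mathbb R\to\operatorname{Imm}(M,\mathbb R^{m+1})$ (smooth maps $(t,x)\mapsto f(t,x)$ with every $f(t,\cdot)$ an immersion) with $f(0)=f_0$ and $\partial_t|_0f=h$, and for every such path the function $(t,x)\mapsto\det(L^{f(t)})(x)$ is smooth on $\mathbb R\times M$ and $\partial_t|_0\det(L^{f(t)})$ is the right-hand side, at every point of $M$. -/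

import Mathlib

open scoped Manifold ContDiff Topology RealInnerProductSpace

namespace HypersurfaceVariation

noncomputable section

/-- The Euclidean space of dimension `k`. -/
abbrev Euc (k : ℕ) : Type := EuclideanSpace ℝ (Fin k)

/-! ### Linear algebra on a tangent space

In Mathlib the tangent space at `x` of a manifold modelled on `Euc m` is, by definition, a copy of
`Euc m`: a tangent vector is given by its components in the preferred chart `chartAt x` at `x`.
Tensors on `T_x M` are therefore written below as multilinear maps on `Euc m`. -/

/-- The inverse `g⁻¹ : V* → V` of a metric `g`, seen as a map `g : V → V*`. -/
def sharp {m : ℕ} (g : Euc m →L[ℝ] Euc m →L[ℝ] ℝ) : (Euc m →L[ℝ] ℝ) →L[ℝ] Euc m :=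
  ContinuousLinearMap.inverse g

/-- The components `g^{ij} = dxⁱ (g⁻¹ dxʲ)` of the inverse metric. -/
def inverseMetricCoeff {m : ℕ} (g : Euc m →L[ℝ] Euc m →L[ℝ] ℝ) (i j : Fin m) : ℝ :=
  EuclideanSpace.proj i (sharp g (EuclideanSpace.proj j))

/-- The product metric `g⁰₂ = g⁻¹ ⊗ g⁻¹` on covariant 2-tensors,
`g⁰₂(B, C) = ∑ g^{ik} g^{jl} B_{ij} C_{kl}`. -/
def tensorInner {m : ℕ} (g B C : Euc m →L[ℝ] Euc m →L[ℝ] ℝ) : ℝ :=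
  ∑ i, ∑ j, ∑ k, ∑ l, inverseMetricCoeff g i k * inverseMetricCoeff g j l *
    B (EuclideanSpace.single i 1) (EuclideanSpace.single j 1) *
    C (EuclideanSpace.single k 1) (EuclideanSpace.single l 1)

set_option maxSynthPendingDepth 5 in
/-- For a trilinear form `G` (the derivative of a metric), the trilinear form
`(v, w, z) ↦ ½ (G(v, w, z) + G(w, v, z) - G(z, v, w))`. -/
def christoffelCombination {V : Type*} [NormedAddCommGroup V] [NormedSpace ℝ V]
    (G : V →L[ℝ] V →L[ℝ] V →L[ℝ] ℝ) : V →L[ℝ] V →L[ℝ] V →L[ℝ] ℝ :=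
  let flipLast : (V →L[ℝ] V →L[ℝ] ℝ) →L[ℝ] (V →L[ℝ] V →L[ℝ] ℝ) :=
    (ContinuousLinearMap.flipₗᵢ ℝ V V ℝ).toContinuousLinearEquiv
  (1 / 2 : ℝ) • (G + G.flip - flipLast.comp G.flip)

/-- The classical adjoint of an endomorphism: its matrix is the adjugate (the transposed matrix of
cofactors) of the matrix of the endomorphism. -/
def classicalAdjoint {m : ℕ} (A : Euc m →L[ℝ] Euc m) : Euc m →L[ℝ] Euc m :=
  let b := (EuclideanSpace.basisFun (Fin m) ℝ).toBasis
  LinearMap.toContinuousLinearMap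
    (Matrix.toLin b b (Matrix.adjugate (LinearMap.toMatrix b b (A : Euc m →ₗ[ℝ] Euc m))))

theorem classicalAdjoint_comp {m : ℕ} (A : Euc m →L[ℝ] Euc m) :
    (classicalAdjoint A).comp A =
      LinearMap.det (A : Euc m →ₗ[ℝ] Euc m) • ContinuousLinearMap.id ℝ (Euc m) := by
  set b := (EuclideanSpace.basisFun (Fin m) ℝ).toBasis with hb
  have key : (Matrix.toLin b b (Matrix.adjugate (LinearMap.toMatrix b b
      (A : Euc m →ₗ[ℝ] Euc m)))) ∘ₗ (A : Euc m →ₗ[ℝ] Euc m) =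
      LinearMap.det (A : Euc m →ₗ[ℝ] Euc m) • LinearMap.id := by
    conv_lhs => rw [← Matrix.toLin_toMatrix b b (A : Euc m →ₗ[ℝ] Euc m)]
    rw [LinearMap.toMatrix_toLin, ← Matrix.toLin_mul, Matrix.adjugate_mul,
      LinearMap.det_toMatrix, map_smul, Matrix.toLin_one]
  ext1 v
  exact congrArg (fun T : Euc m →ₗ[ℝ] Euc m => T v) key

theorem comp_classicalAdjoint {m : ℕ} (A : Euc m →L[ℝ] Euc m) :
    A.comp (classicalAdjoint A) =
      LinearMap.det (A : Euc m →ₗ[ℝ] Euc m) • ContinuousLinearMap.id ℝ (Euc m) := by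
  set b := (EuclideanSpace.basisFun (Fin m) ℝ).toBasis with hb
  have key : (A : Euc m →ₗ[ℝ] Euc m) ∘ₗ (Matrix.toLin b b (Matrix.adjugate
      (LinearMap.toMatrix b b (A : Euc m →ₗ[ℝ] Euc m)))) =
      LinearMap.det (A : Euc m →ₗ[ℝ] Euc m) • LinearMap.id := by
    conv_lhs => rw [← Matrix.toLin_toMatrix b b (A : Euc m →ₗ[ℝ] Euc m)]
    rw [LinearMap.toMatrix_toLin, ← Matrix.toLin_mul, Matrix.mul_adjugate,
      LinearMap.det_toMatrix, map_smul, Matrix.toLin_one]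
  ext1 v
  exact congrArg (fun T : Euc m →ₗ[ℝ] Euc m => T v) key

set_option maxSynthPendingDepth 5 in
theorem christoffelCombination_apply {V : Type*} [NormedAddCommGroup V] [NormedSpace ℝ V]
    (G : V →L[ℝ] V →L[ℝ] V →L[ℝ] ℝ) (v w z : V) :
    christoffelCombination G v w z = 1 / 2 * (G v w z + G w v z - G z v w) := by
  simp [christoffelCombination]

/-! ### Orientations and immersions -/

section Manifold

variable {m : ℕ} {M : Type*} [TopologicalSpace M] [ChartedSpace (Euc m) M]

/-- An orientation of a smooth manifold `M`: an orientation of every tangent space such that near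
every point there is a smooth local frame that is everywhere positive or everywhere negative. -/
structure ManifoldOrientation (m : ℕ) (M : Type*) [TopologicalSpace M] [ChartedSpace (Euc m) M]
    [IsManifold (𝓡 m) ∞ M] where
  /-- The orientation of the tangent space at a point. -/
  at_ : ∀ x : M, Orientation ℝ (TangentSpace (𝓡 m) x) (Fin m)
  exists_frame : ∀ x₀ : M, ∃ u ∈ 𝓝 x₀, ∃ s : Fin m → (x : M) → TangentSpace (𝓡 m) x,
    ∃ hs : IsLocalFrameOn (𝓡 m) (Euc m) ∞ s u,
      (∀ x (hx : x ∈ u), (hs.toBasisAt hx).orientation = at_ x) ∨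
      (∀ x (hx : x ∈ u), (hs.toBasisAt hx).orientation = -at_ x)

/-- The differential `T_x f` of a map into a Euclidean space. -/
def tangentMap (m : ℕ) {M : Type*} [TopologicalSpace M] [ChartedSpace (Euc m) M] {k : ℕ}
    (f : M → Euc k) (x : M) : Euc m →L[ℝ] Euc k :=
  mfderiv (𝓡 m) 𝓘(ℝ, Euc k) f x

/-- Smooth immersions of `M` as a hypersurface of Euclidean space: smooth maps with injective
differential at every point. -/
structure IsSmoothImmersion (f : M → Euc (m + 1)) : Prop where
  contMDiff : ContMDiff (𝓡 m) 𝓘(ℝ, Euc (m + 1)) ∞ f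
  injective : ∀ x, Function.Injective (tangentMap m f x)

/-- `f : ℝ → Imm(M, ℝᵐ⁺¹)` is a smooth path of immersions, that is, `(t, x) ↦ f t x` is smooth and
every `f t` is an immersion, with `f 0 = f₀` and `∂ₜ|₀ f = h`. -/
structure IsVariation (f₀ h : M → Euc (m + 1)) (f : ℝ → M → Euc (m + 1)) : Prop where
  contMDiff : ContMDiff (𝓘(ℝ, ℝ).prod (𝓡 m)) 𝓘(ℝ, Euc (m + 1)) ∞ (fun p : ℝ × M => f p.1 p.2)
  immersion : ∀ t, IsSmoothImmersion (f t)
  initial : f 0 = f₀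
  velocity : ∀ x, HasDerivAt (fun t => f t x) (h x) 0

/-! ### Metric, unit normal field and Weingarten map of an immersion -/

/-- The induced metric `g = f^* ḡ`. -/
def inducedMetric (f : M → Euc (m + 1)) (x : M) : Euc m →L[ℝ] Euc m →L[ℝ] ℝ :=
  (innerSL ℝ : Euc (m + 1) →L[ℝ] Euc (m + 1) →L[ℝ] ℝ).bilinearComp
    (tangentMap m f x) (tangentMap m f x)

/-- `v` is the positively oriented unit normal vector of `f` at `x`: it is a unit vector orthogonal
to the image of `T_x f`, and a basis `b` of `T_x M` is positively oriented if and only if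
`(v, T_x f b₁, …, T_x f bₘ)` is a positively oriented basis of `ℝᵐ⁺¹`. -/
structure IsPositiveUnitNormal [IsManifold (𝓡 m) ∞ M] (o : ManifoldOrientation m M)
    (f : M → Euc (m + 1)) (x : M) (v : Euc (m + 1)) : Prop where
  norm_eq_one : ‖v‖ = 1
  orthogonal : ∀ w, ⟪v, tangentMap m f x w⟫ = 0
  positive : ∀ b : Module.Basis (Fin m) ℝ (TangentSpace (𝓡 m) x),
    0 < (EuclideanSpace.basisFun (Fin (m + 1)) ℝ).toBasis.det
        (Matrix.vecCons v (fun i => tangentMap m f x (b i))) ↔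
      b.orientation = o.at_ x

/-- The positively oriented unit normal field `ν` of an immersion. -/
def unitNormal [IsManifold (𝓡 m) ∞ M] (o : ManifoldOrientation m M) (f : M → Euc (m + 1)) (x : M) :
    Euc (m + 1) :=
  Classical.epsilon (IsPositiveUnitNormal o f x)

/-- The second fundamental form `s(X, Y) = -ḡ(∇_X ν, Tf.Y)`. -/
def secondFundamentalForm [IsManifold (𝓡 m) ∞ M] (o : ManifoldOrientation m M)
    (f : M → Euc (m + 1)) (x : M) : Euc m →L[ℝ] Euc m →L[ℝ] ℝ :=
  -(innerSL ℝ : Euc (m + 1) →L[ℝ] Euc (m + 1) →L[ℝ] ℝ).bilinearComp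
    (tangentMap m (unitNormal o f) x) (tangentMap m f x)

/-- The Weingarten map `L = g⁻¹ s`, that is, `g(L X, Y) = s(X, Y)`. -/
def weingarten [IsManifold (𝓡 m) ∞ M] (o : ManifoldOrientation m M) (f : M → Euc (m + 1)) (x : M) :
    Euc m →L[ℝ] Euc m :=
  (sharp (inducedMetric f x)).comp (secondFundamentalForm o f x)

/-- The mean curvature `Tr(L)`. -/
def meanCurvature [IsManifold (𝓡 m) ∞ M] (o : ManifoldOrientation m M) (f : M → Euc (m + 1))
    (x : M) : ℝ :=
  LinearMap.trace ℝ (Euc m) (weingarten o f x : Euc m →ₗ[ℝ] Euc m)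

/-- The Gauß curvature `det(L)`. -/
def gaussCurvature [IsManifold (𝓡 m) ∞ M] (o : ManifoldOrientation m M) (f : M → Euc (m + 1))
    (x : M) : ℝ :=
  LinearMap.det (weingarten o f x : Euc m →ₗ[ℝ] Euc m)

/-- The normal part `h^⊥ = ḡ(h, ν)` of a field `h` along `f`. -/
def normalPart [IsManifold (𝓡 m) ∞ M] (o : ManifoldOrientation m M) (f h : M → Euc (m + 1))
    (x : M) : ℝ :=
  ⟪h x, unitNormal o f x⟫

/-- The tangential part `h^⊤` of a field `h` along `f`: `g(h^⊤, X) = ḡ(h, Tf.X)` for all `X`. -/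
def tangentialPart (f h : M → Euc (m + 1)) (x : M) : Euc m :=
  sharp (inducedMetric f x) ((innerSL ℝ (h x)).comp (tangentMap m f x))

/-! ### The Levi-Civita connection and the Hessian -/

/-- The expression of a metric `g` on `M` in the preferred chart at `x`, as a function on the
model space: `y ↦ (g_{ij}(y))`. -/
def metricInChart (g : M → Euc m →L[ℝ] Euc m →L[ℝ] ℝ) (x : M) (y : Euc m) :
    Euc m →L[ℝ] Euc m →L[ℝ] ℝ :=
  let A : Euc m →L[ℝ] Euc m := mfderiv 𝓘(ℝ, Euc m) (𝓡 m) (extChartAt (𝓡 m) x).symm y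
  (g ((extChartAt (𝓡 m) x).symm y)).bilinearComp A A

/-- The Christoffel symbols of the first kind at `x`, in the preferred chart at `x`:
`Γ(v, w; z) = ½ (∂_v g(w, z) + ∂_w g(v, z) - ∂_z g(v, w))`. -/
def christoffelFirst (g : M → Euc m →L[ℝ] Euc m →L[ℝ] ℝ) (x : M) :
    Euc m →L[ℝ] Euc m →L[ℝ] Euc m →L[ℝ] ℝ :=
  christoffelCombination (fderiv ℝ (metricInChart g x) (extChartAt (𝓡 m) x x))

theorem christoffelFirst_apply (g : M → Euc m →L[ℝ] Euc m →L[ℝ] ℝ) (x : M) (v w z : Euc m) :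
    christoffelFirst g x v w z =
      1 / 2 * (fderiv ℝ (metricInChart g x) (extChartAt (𝓡 m) x x) v w z +
        fderiv ℝ (metricInChart g x) (extChartAt (𝓡 m) x x) w v z -
        fderiv ℝ (metricInChart g x) (extChartAt (𝓡 m) x x) z v w) := by
  simp only [christoffelFirst, christoffelCombination_apply]

/-- The Christoffel symbols of the Levi-Civita connection `∇` of `g` at `x`, in the preferred chart
at `x`: `Γ(v, w) = ∇_v w` for vector fields with constant components. -/
def christoffel (g : M → Euc m →L[ℝ] Euc m →L[ℝ] ℝ) (x : M) : Euc m →L[ℝ] Euc m →L[ℝ] Euc m :=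
  (ContinuousLinearMap.compL ℝ (Euc m) (Euc m →L[ℝ] ℝ) (Euc m) (sharp (g x))).comp
    (christoffelFirst g x)

/-- The second covariant derivative `∇²φ = ∇dφ` of a function with respect to the Levi-Civita
connection of `g`: in the preferred chart at `x`, `∇²φ(v, w) = ∂_v ∂_w φ - dφ(Γ(v, w))`. -/
def hessian (g : M → Euc m →L[ℝ] Euc m →L[ℝ] ℝ) (φ : M → ℝ) (x : M) :
    Euc m →L[ℝ] Euc m →L[ℝ] ℝ :=
  let u : Euc m → ℝ := φ ∘ (extChartAt (𝓡 m) x).symm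
  let y := extChartAt (𝓡 m) x x
  fderiv ℝ (fderiv ℝ u) y -
    (ContinuousLinearMap.compL ℝ (Euc m) (Euc m) ℝ (fderiv ℝ u y)).comp (christoffel g x)

theorem hessian_apply (g : M → Euc m →L[ℝ] Euc m →L[ℝ] ℝ) (φ : M → ℝ) (x : M) (v w : Euc m) :
    hessian g φ x v w =
      fderiv ℝ (fderiv ℝ (φ ∘ (extChartAt (𝓡 m) x).symm)) (extChartAt (𝓡 m) x x) v w -
      fderiv ℝ (φ ∘ (extChartAt (𝓡 m) x).symm) (extChartAt (𝓡 m) x x)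
        (sharp (g x) (christoffelFirst g x v w)) := by
  simp [hessian, christoffel]

/-- The differential `dφ(X)` of a function in the direction of a tangent vector. -/
def differential (φ : M → ℝ) (x : M) (X : Euc m) : ℝ :=
  mfderiv (𝓡 m) 𝓘(ℝ, ℝ) φ x X

end Manifold

end

end HypersurfaceVariation

namespace HypersurfaceVariation

noncomputable section

/-! ### The generalized cross product -/

/-! The statement is local, and it reduces to the first variation of the Weingarten map of a family
of hypersurface patches `F(t, y)` with unit normal `N`. Split the velocity at a point as `∂ₜF = A N
+ dF(X)`, where `A` is a number and `X` a tangent vector. Differentiate `⟪N, N⟫ = 1` and `⟪N, ∂F⟫ =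
0` up to second order, and use the symmetry of mixed partial derivatives together with `∂ᵥN = -dF(L
v)`. This gives `∂ₜL = g⁻¹∇²A + A L² + D_X L + (L R - R L)`, with `∇²A` the Hessian of the normal
velocity, `D_X` the derivative of components, and `R = P - Γ(X, ·)`, where `P v` is the tangential
part of `∂ₜ∂ᵥF`. The last two terms together are the Lie derivative of `L` along the tangential
velocity; the exact form of `R` does not matter. This is `PatchIdentities.fderiv_patchWeingarten`.

By Jacobi's formula the derivative of `det L` is `Tr(C(L) ∂ₜL)`. The four terms contribute
`g⁰₂(g.C(L), ∇²A)` (`tensorInner_comp`), `A det(L) Tr(L)` because `C(L) L = det(L)`, `D_X det(L)` by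
Jacobi's formula again, and `0`, since the trace of `C(L)` times a commutator with `L` vanishes.

To pass to `M`, the unit normal is written near each point as the normalized cross product of the
coordinate tangent vectors, times a sign `ε` that depends neither on the nearby point nor on `t`
(`exists_unitNormal_eq_patchNormal`). Hence the normal is smooth in `(t, x)`, and the patch
Weingarten map is conjugate to the one on `M`. At the base point of the preferred chart the
coordinate frame is the identity, so the patch formula there is already the intrinsic one.

Paths with given velocity exist because being an immersion is an open condition and `M` is compact:
`f₀ + ρ(t) h` works for a small bounded `ρ` with `ρ(0) = 0` and `ρ'(0) = 1`. -/

/-- The cross product of `m` vectors in `ℝᵐ⁺¹`: the vector with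
`⟪w, cross v⟫ = det (w, v₁, …, vₘ)`. -/
def cross {m : ℕ} (v : Fin m → Euc (m + 1)) : Euc (m + 1) :=
  WithLp.toLp 2 fun j => (EuclideanSpace.basisFun (Fin (m + 1)) ℝ).toBasis.det
    (Matrix.vecCons (EuclideanSpace.single j 1) v)

theorem inner_cross {m : ℕ} (w : Euc (m + 1)) (v : Fin m → Euc (m + 1)) :
    ⟪w, cross v⟫ = (EuclideanSpace.basisFun (Fin (m + 1)) ℝ).toBasis.det (Matrix.vecCons w v) := by
  set D := (EuclideanSpace.basisFun (Fin (m + 1)) ℝ).toBasis.det with hD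
  have hw : w = ∑ j, w j • (EuclideanSpace.single j 1 : Euc (m + 1)) := by
    ext i
    simp [Pi.single_apply]
  have h1 : D (Matrix.vecCons w v) = D.curryLeft w v := rfl
  have h2 : D.curryLeft w v = ∑ j, w j * D (Matrix.vecCons (EuclideanSpace.single j 1) v) := by
    let l : Euc (m + 1) →ₗ[ℝ] ℝ :=
      { toFun := fun u => D.curryLeft u v
        map_add' := fun a b => by simp
        map_smul' := fun c a => by simp }
    have h3 : D.curryLeft w v = l w := rfl
    rw [h3]
    conv_lhs => rw [hw]
    rw [map_sum]
    exact Finset.sum_congr rfl fun j _ => map_smul l _ _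
  rw [h1, h2, PiLp.inner_apply]
  refine Finset.sum_congr rfl fun j _ => ?_
  simp [cross, mul_comm, ← hD]

theorem inner_cross_self {m : ℕ} (v : Fin m → Euc (m + 1)) (i : Fin m) : ⟪v i, cross v⟫ = 0 := by
  rw [inner_cross]
  exact AlternatingMap.map_eq_zero_of_eq _ _ (i := 0) (j := i.succ) (by simp)
    (Fin.succ_ne_zero i).symm

/-- The `m` vectors span a proper subspace; any `w` outside it completes them to a basis, whose
nonzero determinant is `⟪w, cross v⟫`. -/
theorem cross_ne_zero {m : ℕ} {v : Fin m → Euc (m + 1)} (hv : LinearIndependent ℝ v) :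
    cross v ≠ 0 := by
  intro h0
  have hlt : Submodule.span ℝ (Set.range v) < ⊤ := by
    apply lt_top_iff_ne_top.2
    intro htop
    have h1 := finrank_span_eq_card hv
    rw [htop, finrank_top] at h1
    simp at h1
  obtain ⟨w, -, hw⟩ := SetLike.exists_of_lt hlt
  have hli : LinearIndependent ℝ (Matrix.vecCons w v) := linearIndependent_finCons.2 ⟨hv, hw⟩
  have hs := hli.span_eq_top_of_card_eq_finrank (by simp)
  have := (Module.Basis.is_basis_iff_det (EuclideanSpace.basisFun (Fin (m + 1)) ℝ).toBasis).1
    ⟨hli, hs⟩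
  rw [← inner_cross, h0, inner_zero_right] at this
  simp at this

/-- A vector orthogonal to `v₁, …, vₘ` and to their nonzero cross product vanishes. -/
theorem eq_zero_of_inner_cross {m : ℕ} {v : Fin m → Euc (m + 1)} (hv : cross v ≠ 0)
    {w : Euc (m + 1)} (h0 : ⟪w, cross v⟫ = 0) (hw : ∀ i, ⟪w, v i⟫ = 0) : w = 0 := by
  -- This determinant equals `‖cross v‖²`, so the cross product completes the `vᵢ` to a basis.
  have hdet : (EuclideanSpace.basisFun (Fin (m + 1)) ℝ).toBasis.det
      (Matrix.vecCons (cross v) v) ≠ 0 := by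
    rw [← inner_cross]
    exact inner_self_ne_zero.2 hv
  obtain ⟨-, hs⟩ := (Module.Basis.is_basis_iff_det
    (EuclideanSpace.basisFun (Fin (m + 1)) ℝ).toBasis).2 (isUnit_iff_ne_zero.2 hdet)
  have key : ∀ u ∈ Submodule.span ℝ (Set.range (Matrix.vecCons (cross v) v)), ⟪w, u⟫ = 0 := by
    intro u hu
    induction hu using Submodule.span_induction with
    | mem u hu =>
      obtain ⟨i, rfl⟩ := hu
      refine Fin.cases ?_ (fun i => ?_) i
      · simpa using h0
      · simpa using hw i
    | zero => simp
    | add a b _ _ ha hb => rw [inner_add_right, ha, hb, add_zero]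
    | smul c a _ ha => rw [inner_smul_right, ha, mul_zero]
  have := key w (hs ▸ Submodule.mem_top)
  exact inner_self_eq_zero.1 this

theorem contDiff_cross {m : ℕ} {n : WithTop ℕ∞} :
    ContDiff ℝ n (cross : (Fin m → Euc (m + 1)) → Euc (m + 1)) := by
  rw [contDiff_euclidean]
  intro j
  simp only [cross, Module.Basis.det_apply, Matrix.det_apply]
  refine ContDiff.sum fun σ _ => ?_
  refine ContDiff.const_smul _ ?_
  refine contDiff_prod fun i _ => ?_
  refine Fin.cases ?_ (fun k => ?_) i
  · simp only [Module.Basis.toMatrix_apply, Matrix.cons_val_zero]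
    exact contDiff_const
  · simp only [Module.Basis.toMatrix_apply, Matrix.cons_val_succ]
    simp only [OrthonormalBasis.coe_toBasis_repr_apply, EuclideanSpace.basisFun_repr]
    fun_prop

/-- For fixed `w`, pairing with `w` gives an alternating `m`-form in the vectors `vᵢ` of an
`m`-dimensional space, hence a multiple of `b.det`. This is how orientations of bases are compared
with signs of normals. -/
theorem cross_comp_basis {m : ℕ} (A : Euc m →L[ℝ] Euc (m + 1)) (b : Module.Basis (Fin m) ℝ (Euc m))
    (v : Fin m → Euc m) : cross (fun i => A (v i)) = b.det v • cross (fun i => A (b i)) := by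
  refine ext_inner_left ℝ fun w => ?_
  rw [inner_smul_right, inner_cross, inner_cross]
  set D := (EuclideanSpace.basisFun (Fin (m + 1)) ℝ).toBasis.det
  have h := congrArg (fun f : (Euc m) [⋀^Fin m]→ₗ[ℝ] ℝ => f v)
    (((D.curryLeft w).compLinearMap (A : Euc m →ₗ[ℝ] Euc (m + 1))).eq_smul_basis_det b)
  simp only [AlternatingMap.smul_apply, smul_eq_mul] at h
  rw [mul_comm]
  exact h

/-! ### Derivatives of determinants -/

theorem hasDerivAt_matrix_det {n : Type*} [Fintype n] [DecidableEq n] {A : ℝ → Matrix n n ℝ}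
    {A' : Matrix n n ℝ} {t : ℝ} (h : ∀ i j, HasDerivAt (fun s => A s i j) (A' i j) t) :
    HasDerivAt (fun s => (A s).det) (Matrix.trace (Matrix.adjugate (A t) * A')) t := by
  have h1 : ∀ σ : Equiv.Perm n, HasDerivAt (fun s => ∏ i, A s (σ i) i)
      (∑ i, (∏ j ∈ Finset.univ.erase i, A t (σ j) j) • A' (σ i) i) t := fun σ =>
    HasDerivAt.fun_finsetProd fun i _ => h (σ i) i
  have h2 : HasDerivAt (fun s => (A s).det) (∑ σ : Equiv.Perm n, Equiv.Perm.sign σ •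
      ∑ i, (∏ j ∈ Finset.univ.erase i, A t (σ j) j) • A' (σ i) i) t := by
    simp only [Matrix.det_apply]
    exact HasDerivAt.fun_sum fun σ _ => (h1 σ).const_smul _
  convert h2 using 1
  -- Cramer's rule: the `i`-th diagonal entry is the determinant of `A t` with column `i` replaced
  -- by that of `A'`, which is the part of the Leibniz expansion where the factor `i` is
  -- differentiated.
  have h3 : ∀ i, (Matrix.adjugate (A t) * A') i i =
      ∑ σ : Equiv.Perm n, Equiv.Perm.sign σ •
        ((∏ j ∈ Finset.univ.erase i, A t (σ j) j) • A' (σ i) i) := by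
    intro i
    have e1 : (Matrix.adjugate (A t) * A') i i = Matrix.cramer (A t) (fun k => A' k i) i := by
      rw [Matrix.cramer_eq_adjugate_mulVec]
      rfl
    rw [e1, Matrix.cramer_apply, Matrix.det_apply]
    refine Finset.sum_congr rfl fun σ _ => ?_
    congr 1
    rw [← Finset.prod_erase_mul _ _ (Finset.mem_univ i), smul_eq_mul]
    congr 1
    · refine Finset.prod_congr rfl fun j hj => ?_
      rw [Matrix.updateCol_ne (Finset.ne_of_mem_erase hj)]
    · simp
  simp only [Matrix.trace, Matrix.diag_apply, h3]
  rw [Finset.sum_comm]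
  simp only [Finset.smul_sum]

theorem trace_classicalAdjoint_comp {m : ℕ} (A B : Euc m →L[ℝ] Euc m) :
    LinearMap.trace ℝ (Euc m) (((classicalAdjoint A).comp B : Euc m →L[ℝ] Euc m) :
        Euc m →ₗ[ℝ] Euc m) =
      Matrix.trace (Matrix.adjugate (LinearMap.toMatrix
          (EuclideanSpace.basisFun (Fin m) ℝ).toBasis (EuclideanSpace.basisFun (Fin m) ℝ).toBasis
          (A : Euc m →ₗ[ℝ] Euc m)) *
        LinearMap.toMatrix (EuclideanSpace.basisFun (Fin m) ℝ).toBasis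
          (EuclideanSpace.basisFun (Fin m) ℝ).toBasis (B : Euc m →ₗ[ℝ] Euc m)) := by
  set b := (EuclideanSpace.basisFun (Fin m) ℝ).toBasis
  rw [LinearMap.trace_eq_matrix_trace ℝ b, ContinuousLinearMap.toLinearMap_comp,
    LinearMap.toMatrix_comp b b b]
  congr 2
  exact LinearMap.toMatrix_toLin b b _

theorem hasDerivAt_det {m : ℕ} {A : ℝ → Euc m →L[ℝ] Euc m} {A' : Euc m →L[ℝ] Euc m} {t : ℝ}
    (h : HasDerivAt A A' t) :
    HasDerivAt (fun s => LinearMap.det (A s : Euc m →ₗ[ℝ] Euc m))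
      (LinearMap.trace ℝ (Euc m)
        (((classicalAdjoint (A t)).comp A' : Euc m →L[ℝ] Euc m) : Euc m →ₗ[ℝ] Euc m)) t := by
  set b := (EuclideanSpace.basisFun (Fin m) ℝ).toBasis with hb
  rw [trace_classicalAdjoint_comp]
  simp only [← LinearMap.det_toMatrix b]
  refine hasDerivAt_matrix_det fun i j => ?_
  simp only [LinearMap.toMatrix_apply, hb, OrthonormalBasis.coe_toBasis_repr_apply,
    EuclideanSpace.basisFun_repr, OrthonormalBasis.coe_toBasis, ContinuousLinearMap.coe_coe]
  exact (EuclideanSpace.proj i : Euc m →L[ℝ] ℝ).hasFDerivAt.comp_hasDerivAt t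
    (h.clm_apply (hasDerivAt_const t _)) |>.congr_deriv (by simp)

theorem contDiff_det {m : ℕ} {n : WithTop ℕ∞} :
    ContDiff ℝ n (fun A : Euc m →L[ℝ] Euc m => LinearMap.det (A : Euc m →ₗ[ℝ] Euc m)) := by
  set b := (EuclideanSpace.basisFun (Fin m) ℝ).toBasis with hb
  simp only [← LinearMap.det_toMatrix b, Matrix.det_apply]
  refine ContDiff.sum fun σ _ => ContDiff.const_smul _ (contDiff_prod fun i _ => ?_)
  simp only [LinearMap.toMatrix_apply, hb, OrthonormalBasis.coe_toBasis_repr_apply,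
    EuclideanSpace.basisFun_repr, OrthonormalBasis.coe_toBasis, ContinuousLinearMap.coe_coe]
  fun_prop

/-- By cyclicity of the trace and `C(A) A = A C(A) = det(A)`, both products have trace `det(A)
Tr(B)`. This removes the unspecified commutator term from the variation of the Weingarten map. -/
theorem trace_classicalAdjoint_comp_commutator {m : ℕ} (A B : Euc m →L[ℝ] Euc m) :
    LinearMap.trace ℝ (Euc m) (((classicalAdjoint A).comp (A.comp B - B.comp A) :
      Euc m →L[ℝ] Euc m) : Euc m →ₗ[ℝ] Euc m) = 0 := by
  have h1 : (classicalAdjoint A).comp (A.comp B) =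
      LinearMap.det (A : Euc m →ₗ[ℝ] Euc m) • B := by
    rw [← ContinuousLinearMap.comp_assoc, classicalAdjoint_comp]
    ext1 v
    rfl
  have h2 : LinearMap.trace ℝ (Euc m) (((classicalAdjoint A).comp (B.comp A) :
      Euc m →L[ℝ] Euc m) : Euc m →ₗ[ℝ] Euc m) =
      LinearMap.trace ℝ (Euc m) ((LinearMap.det (A : Euc m →ₗ[ℝ] Euc m) • B :
        Euc m →L[ℝ] Euc m) : Euc m →ₗ[ℝ] Euc m) := by
    rw [← ContinuousLinearMap.comp_assoc, ContinuousLinearMap.toLinearMap_comp,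
      LinearMap.trace_comp_comm', ← ContinuousLinearMap.toLinearMap_comp,
      ← ContinuousLinearMap.comp_assoc, comp_classicalAdjoint]
    rfl
  rw [ContinuousLinearMap.comp_sub, ContinuousLinearMap.toLinearMap_sub, map_sub, h2, h1, sub_self]

theorem trace_classicalAdjoint_comp_sq {m : ℕ} (A : Euc m →L[ℝ] Euc m) :
    LinearMap.trace ℝ (Euc m) (((classicalAdjoint A).comp (A.comp A) :
      Euc m →L[ℝ] Euc m) : Euc m →ₗ[ℝ] Euc m) =
    LinearMap.det (A : Euc m →ₗ[ℝ] Euc m) *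
      LinearMap.trace ℝ (Euc m) (A : Euc m →ₗ[ℝ] Euc m) := by
  rw [← ContinuousLinearMap.comp_assoc, classicalAdjoint_comp, ContinuousLinearMap.smul_comp,
    ContinuousLinearMap.id_comp, ContinuousLinearMap.toLinearMap_smul, map_smul, smul_eq_mul]

/-! ### Metrics -/

theorem sharp_apply {m : ℕ} {g : Euc m →L[ℝ] Euc m →L[ℝ] ℝ} (hg : g.IsInvertible)
    (l : Euc m →L[ℝ] ℝ) : g (sharp g l) = l := by
  obtain ⟨e, rfl⟩ := hg
  simp [sharp]

/-- Definiteness forces injectivity, and a space and its dual have the same finite dimension. -/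
theorem isInvertible_of_pos {m : ℕ} {g : Euc m →L[ℝ] Euc m →L[ℝ] ℝ}
    (hg : ∀ v, g v v = 0 → v = 0) : g.IsInvertible := by
  have hinj : Function.Injective (g : Euc m →ₗ[ℝ] Euc m →L[ℝ] ℝ) := by
    refine (injective_iff_map_eq_zero _).2 fun v hv => hg v ?_
    have : g v = 0 := hv
    simp [this]
  have hdim : Module.finrank ℝ (Euc m) = Module.finrank ℝ (Euc m →L[ℝ] ℝ) := by
    rw [(LinearMap.toContinuousLinearMap (𝕜 := ℝ) (E := Euc m) (F' := ℝ)).symm.finrank_eq,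
      Module.finrank_linearMap]
    simp
  exact ⟨(LinearEquiv.ofInjectiveOfFinrankEq (g : Euc m →ₗ[ℝ] Euc m →L[ℝ] ℝ) hinj
    hdim).toContinuousLinearEquiv, by ext; rfl⟩

theorem sharp_apply_coord {m : ℕ} (g : Euc m →L[ℝ] Euc m →L[ℝ] ℝ) (l : Euc m →L[ℝ] ℝ)
    (i : Fin m) :
    sharp g l i = ∑ k, inverseMetricCoeff g i k * l (EuclideanSpace.single k 1) := by
  have hl : l = ∑ k, l (EuclideanSpace.single k 1) • (EuclideanSpace.proj k : Euc m →L[ℝ] ℝ) := by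
    ext v
    have hv : v = ∑ j, v j • (EuclideanSpace.single j 1 : Euc m) := by
      ext i
      simp [Pi.single_apply]
    conv_lhs => rw [hv]
    simp [mul_comm]
  conv_lhs => rw [hl]
  simp [inverseMetricCoeff, mul_comm]

/-- `g⁰₂(g.C, H) = Tr(C g⁻¹H)` for symmetric `H`. -/
theorem tensorInner_comp {m : ℕ} {g : Euc m →L[ℝ] Euc m →L[ℝ] ℝ} (hg : g.IsInvertible)
    (hs : ∀ v w, g v w = g w v) (C : Euc m →L[ℝ] Euc m) {H : Euc m →L[ℝ] Euc m →L[ℝ] ℝ}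
    (hH : ∀ v w, H v w = H w v) :
    tensorInner g (g.comp C) H =
      LinearMap.trace ℝ (Euc m) ((C.comp ((sharp g).comp H) : Euc m →L[ℝ] Euc m) :
        Euc m →ₗ[ℝ] Euc m) := by
  have hsum : ∀ (l : Euc m →L[ℝ] ℝ) (v : Euc m),
      ∑ j, l (EuclideanSpace.single j 1) * v j = l v := by
    intro l v
    have hv : v = ∑ j, v j • (EuclideanSpace.single j 1 : Euc m) := by
      ext i
      simp [Pi.single_apply]
    conv_rhs => rw [hv]
    simp [mul_comm]
  -- The sum over `l` turns `H eₖ` into the vector `g⁻¹(H eₖ)`; the sum over `j` then pairs it with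
  -- `C eᵢ` through `g`, which cancels `g⁻¹`.
  have h1 : ∀ i k, ∑ j, ∑ l, inverseMetricCoeff g i k * inverseMetricCoeff g j l *
      (g.comp C) (EuclideanSpace.single i 1) (EuclideanSpace.single j 1) *
      H (EuclideanSpace.single k 1) (EuclideanSpace.single l 1) =
      inverseMetricCoeff g i k * H (C (EuclideanSpace.single i 1)) (EuclideanSpace.single k 1) := by
    intro i k
    rw [hH, ← sharp_apply hg (H (EuclideanSpace.single k 1)), hs, ← hsum, Finset.mul_sum]
    refine Finset.sum_congr rfl fun j _ => ?_
    rw [sharp_apply_coord, Finset.mul_sum, Finset.mul_sum]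
    refine Finset.sum_congr rfl fun l _ => ?_
    rw [sharp_apply hg]
    simp only [ContinuousLinearMap.comp_apply]
    ring
  have h2 : tensorInner g (g.comp C) H =
      ∑ i, sharp g (H (C (EuclideanSpace.single i 1))) i := by
    unfold tensorInner
    refine Finset.sum_congr rfl fun i _ => ?_
    rw [Finset.sum_comm' (t' := Finset.univ) (s' := fun _ => Finset.univ) (by simp)]
    rw [sharp_apply_coord]
    refine Finset.sum_congr rfl fun k _ => ?_
    rw [h1]
  rw [h2, ContinuousLinearMap.toLinearMap_comp, LinearMap.trace_comp_comm',
    LinearMap.trace_eq_matrix_trace ℝ (EuclideanSpace.basisFun (Fin m) ℝ).toBasis]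
  simp [Matrix.trace, LinearMap.toMatrix_apply]

/-! ### Families of hypersurface patches over an open set of the model space -/

section Patch

variable {m : ℕ} {V : Type*} [NormedAddCommGroup V] [InnerProductSpace ℝ V]

theorem two_le_smooth : (2 : WithTop ℕ∞) ≤ ∞ := 
  WithTop.coe_le_coe.2 (le_top : (2 : ℕ∞) ≤ ⊤)

/-- The derivative in the space variables of a map on `ℝ × ℝᵐ`. -/
def spaceDeriv (F : ℝ × Euc m → V) (z : ℝ × Euc m) : Euc m →L[ℝ] V :=
  (fderiv ℝ F z).comp (ContinuousLinearMap.inr ℝ ℝ (Euc m))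

/-- The bilinear form `(v, w) ↦ ⟪A v, B w⟫`. -/
def gram (A B : Euc m →L[ℝ] V) : Euc m →L[ℝ] Euc m →L[ℝ] ℝ :=
  (innerSL ℝ : V →L[ℝ] V →L[ℝ] ℝ).bilinearComp A B

/-- The Weingarten map of a family of hypersurface patches `F` with normal field `N`. -/
def patchWeingarten (F N : ℝ × Euc m → V) (z : ℝ × Euc m) : Euc m →L[ℝ] Euc m :=
  (sharp (gram (spaceDeriv F z) (spaceDeriv F z))).comp (-gram (spaceDeriv N z) (spaceDeriv F z))

/-- Near `z`, the family `F(t, ·)` consists of immersed hypersurface patches with unit normal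
field `N(t, ·)`. -/
structure IsPatchFamilyAt (F N : ℝ × Euc m → V) (z : ℝ × Euc m) : Prop where
  contDiffAt : ∀ᶠ p in 𝓝 z, ContDiffAt ℝ ∞ F p
  contDiffAt_normal : ∀ᶠ p in 𝓝 z, ContDiffAt ℝ ∞ N p
  injective : ∀ᶠ p in 𝓝 z, Function.Injective (spaceDeriv F p)
  unit : ∀ᶠ p in 𝓝 z, ⟪N p, N p⟫ = 1
  orthogonal : ∀ᶠ p in 𝓝 z, ∀ w, ⟪N p, spaceDeriv F p w⟫ = 0
  spanning : ∀ᶠ p in 𝓝 z, ∀ u, ⟪u, N p⟫ = 0 → (∀ w, ⟪u, spaceDeriv F p w⟫ = 0) → u = 0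

theorem gram_apply (A B : Euc m →L[ℝ] V) (v w : Euc m) : gram A B v w = ⟪A v, B w⟫ := rfl

theorem isInvertible_gram {A : Euc m →L[ℝ] V} (hA : Function.Injective A) :
    (gram A A).IsInvertible :=
  isInvertible_of_pos fun v hv => hA (by rw [map_zero]; exact inner_self_eq_zero.1 hv)

theorem contDiffAt_gram {E : Type*} [NormedAddCommGroup E] [NormedSpace ℝ E]
    {n : WithTop ℕ∞} {A B : E → Euc m →L[ℝ] V} {z : E} (hA : ContDiffAt ℝ n A z)
    (hB : ContDiffAt ℝ n B z) : ContDiffAt ℝ n (fun p => gram (A p) (B p)) z := by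
  have h : ∀ p, gram (A p) (B p) =
      ((ContinuousLinearMap.compL ℝ (Euc m) V ℝ).flip (B p)).comp ((innerSL ℝ).comp (A p)) :=
    fun p => by ext; rfl
  simp only [h]
  fun_prop

theorem contDiffAt_spaceDeriv {F : ℝ × Euc m → V} {z : ℝ × Euc m} (hF : ContDiffAt ℝ ∞ F z) :
    ContDiffAt ℝ ∞ (spaceDeriv F) z :=
  (hF.fderiv_right (m := ∞) (by simp)).clm_comp contDiffAt_const

theorem contDiffAt_patchWeingarten {F N : ℝ × Euc m → V} {z : ℝ × Euc m}
    (hF : ContDiffAt ℝ ∞ F z) (hN : ContDiffAt ℝ ∞ N z)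
    (hi : Function.Injective (spaceDeriv F z)) :
    ContDiffAt ℝ ∞ (patchWeingarten F N) z := by
  have h1 : ContDiffAt ℝ ∞ (fun p => gram (spaceDeriv F p) (spaceDeriv F p)) z :=
    contDiffAt_gram (contDiffAt_spaceDeriv hF) (contDiffAt_spaceDeriv hF)
  have h2 : ContDiffAt ℝ ∞ (fun p => gram (spaceDeriv N p) (spaceDeriv F p)) z :=
    contDiffAt_gram (contDiffAt_spaceDeriv hN) (contDiffAt_spaceDeriv hF)
  have h3 : ContDiffAt ℝ ∞ (fun p => sharp (gram (spaceDeriv F p) (spaceDeriv F p))) z := by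
    -- Inversion is smooth at invertible maps, and an injective differential makes the induced
    -- metric invertible.
    have h4 : ContDiffAt ℝ ∞ (sharp (m := m)) (gram (spaceDeriv F z) (spaceDeriv F z)) :=
      (isInvertible_gram hi).contDiffAt_map_inverse
    exact h4.comp z h1
  exact h3.clm_comp h2.neg

/-- The Weingarten equation. The sum of `∂ᵥN` and `dF(L v)` is orthogonal to `N` because `N` has
constant length, and to the tangent vectors by the definition of `L`; so it vanishes. It holds on a
neighbourhood and can therefore be differentiated. -/
theorem spaceDeriv_patchWeingarten {F N : ℝ × Euc m → V} {z : ℝ × Euc m}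
    (h : IsPatchFamilyAt F N z) :
    ∀ᶠ p in 𝓝 z, ∀ v, spaceDeriv N p v = -spaceDeriv F p (patchWeingarten F N p v) := by
  filter_upwards [h.contDiffAt_normal, h.injective, h.unit.eventually_nhds, h.orthogonal,
    h.spanning] with p hN hi hu ho hs v
  have hN' := (hN.differentiableAt (by simp)).hasFDerivAt
  have h0 : ⟪N p, fderiv ℝ N p (0, v)⟫ = 0 := by
    have h1 := (hN'.inner ℝ hN').congr_of_eventuallyEq
      (hu.mono fun q hq => hq.symm : (fun _ => (1 : ℝ)) =ᶠ[𝓝 p] fun q => ⟪N q, N q⟫)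
    have h2 := congrArg (fun T : ℝ × Euc m →L[ℝ] ℝ => T (0, v))
      (h1.unique (hasFDerivAt_const (1 : ℝ) p))
    simp [fderivInnerCLM_apply, real_inner_comm] at h2
    exact h2
  rw [eq_neg_iff_add_eq_zero]
  apply hs
  · rw [inner_add_left, real_inner_comm, real_inner_comm (N p), ho]
    simpa [spaceDeriv] using h0
  · intro w
    rw [inner_add_left, ← gram_apply (spaceDeriv F p) (spaceDeriv F p), patchWeingarten,
      ContinuousLinearMap.comp_apply, sharp_apply (isInvertible_gram hi)]
    simp [gram_apply]

/-- The identities between the derivatives up to third order of a family of hypersurface patches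
and the derivatives up to second order of its normal field. -/
structure PatchIdentities (F N : ℝ × Euc m → V) (z : ℝ × Euc m) : Prop where
  symm : ∀ ζ η, fderiv ℝ (fderiv ℝ F) z ζ η = fderiv ℝ (fderiv ℝ F) z η ζ
  symm_normal : ∀ ζ η, fderiv ℝ (fderiv ℝ N) z ζ η = fderiv ℝ (fderiv ℝ N) z η ζ
  symm_third : ∀ θ ζ η, fderiv ℝ (fderiv ℝ (fderiv ℝ F)) z θ ζ η =
    fderiv ℝ (fderiv ℝ (fderiv ℝ F)) z θ η ζ
  unit : ⟪N z, N z⟫ = 1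
  unit_deriv : ∀ ζ, ⟪N z, fderiv ℝ N z ζ⟫ = 0
  unit_deriv_two : ∀ ζ η, ⟪fderiv ℝ N z ζ, fderiv ℝ N z η⟫ +
    ⟪N z, fderiv ℝ (fderiv ℝ N) z ζ η⟫ = 0
  orthogonal : ∀ w, ⟪N z, fderiv ℝ F z (0, w)⟫ = 0
  orthogonal_deriv : ∀ ζ w, ⟪fderiv ℝ N z ζ, fderiv ℝ F z (0, w)⟫ +
    ⟪N z, fderiv ℝ (fderiv ℝ F) z ζ (0, w)⟫ = 0
  orthogonal_deriv_two : ∀ η ζ w, ⟪fderiv ℝ (fderiv ℝ N) z η ζ, fderiv ℝ F z (0, w)⟫ +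
    ⟪fderiv ℝ N z ζ, fderiv ℝ (fderiv ℝ F) z η (0, w)⟫ +
    ⟪fderiv ℝ N z η, fderiv ℝ (fderiv ℝ F) z ζ (0, w)⟫ +
    ⟪N z, fderiv ℝ (fderiv ℝ (fderiv ℝ F)) z η ζ (0, w)⟫ = 0
  weingarten : ∀ v, fderiv ℝ N z (0, v) = -fderiv ℝ F z (0, patchWeingarten F N z v)
  weingarten_deriv : ∀ ζ v, fderiv ℝ (fderiv ℝ N) z ζ (0, v) =
    -fderiv ℝ (fderiv ℝ F) z ζ (0, patchWeingarten F N z v) -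
      fderiv ℝ F z (0, fderiv ℝ (patchWeingarten F N) z ζ v)

/-- The derivative of a locally constant function vanishes. -/
theorem HasFDerivAt.eq_zero_of_eventually {E W : Type*} [NormedAddCommGroup E] [NormedSpace ℝ E]
    [NormedAddCommGroup W] [NormedSpace ℝ W] {f : E → W} {f' : E →L[ℝ] W} {z : E} {c : W}
    (h : HasFDerivAt f f' z) (hc : ∀ᶠ p in 𝓝 z, f p = c) (ζ : E) : f' ζ = 0 := by
  have h1 := h.congr_of_eventuallyEq
    (hc.mono fun q hq => hq.symm : (fun _ => c) =ᶠ[𝓝 z] f)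
  rw [h1.unique (hasFDerivAt_const c z)]
  rfl

/-- Each identity is a pointwise relation valid near `z`, or a derivative of such a relation. Time
and space directions are treated together as vectors `(1, 0)` and `(0, v)` of the product, so mixed
derivatives need no separate argument. -/
theorem IsPatchFamilyAt.identities {F N : ℝ × Euc m → V} {z : ℝ × Euc m}
    (h : IsPatchFamilyAt F N z) : PatchIdentities F N z := by
  have hF1 : ∀ᶠ p in 𝓝 z, HasFDerivAt F (fderiv ℝ F p) p :=
    h.contDiffAt.mono fun p hp => (hp.differentiableAt (by simp)).hasFDerivAt
  have hF2 : ∀ᶠ p in 𝓝 z, HasFDerivAt (fderiv ℝ F) (fderiv ℝ (fderiv ℝ F) p) p :=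
    h.contDiffAt.mono fun p hp =>
      ((hp.fderiv_right (m := ∞) (by simp)).differentiableAt (by simp)).hasFDerivAt
  have hF3 : HasFDerivAt (fderiv ℝ (fderiv ℝ F)) (fderiv ℝ (fderiv ℝ (fderiv ℝ F)) z) z :=
    (((h.contDiffAt.self_of_nhds.fderiv_right (m := ∞) (by simp)).fderiv_right
      (m := ∞) (by simp)).differentiableAt (by simp)).hasFDerivAt
  have hN1 : ∀ᶠ p in 𝓝 z, HasFDerivAt N (fderiv ℝ N p) p :=
    h.contDiffAt_normal.mono fun p hp => (hp.differentiableAt (by simp)).hasFDerivAt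
  have hN2 : HasFDerivAt (fderiv ℝ N) (fderiv ℝ (fderiv ℝ N) z) z :=
    ((h.contDiffAt_normal.self_of_nhds.fderiv_right (m := ∞) (by simp)).differentiableAt
      (by simp)).hasFDerivAt
  have hL : HasFDerivAt (patchWeingarten F N) (fderiv ℝ (patchWeingarten F N) z) z :=
    ((contDiffAt_patchWeingarten h.contDiffAt.self_of_nhds h.contDiffAt_normal.self_of_nhds
      h.injective.self_of_nhds).differentiableAt (by simp)).hasFDerivAt
  have hsymm : ∀ᶠ p in 𝓝 z, ∀ ζ η, fderiv ℝ (fderiv ℝ F) p ζ η = fderiv ℝ (fderiv ℝ F) p η ζ :=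
    h.contDiffAt.mono fun p hp => hp.isSymmSndFDerivAt (by simpa using two_le_smooth)
  have hud : ∀ᶠ p in 𝓝 z, ∀ ζ, ⟪N p, fderiv ℝ N p ζ⟫ = 0 := by
    filter_upwards [hN1, h.unit.eventually_nhds] with p hp hu ζ
    have := HasFDerivAt.eq_zero_of_eventually (hp.inner ℝ hp) hu ζ
    simp [fderivInnerCLM_apply, real_inner_comm] at this
    exact this
  have hod : ∀ᶠ p in 𝓝 z, ∀ ζ w, ⟪fderiv ℝ N p ζ, fderiv ℝ F p (0, w)⟫ +
      ⟪N p, fderiv ℝ (fderiv ℝ F) p ζ (0, w)⟫ = 0 := by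
    filter_upwards [hN1, hF2, h.orthogonal.eventually_nhds] with p hN hF ho ζ w
    have := HasFDerivAt.eq_zero_of_eventually
      (hN.inner ℝ (hF.clm_apply (hasFDerivAt_const ((0, w) : ℝ × Euc m) p)))
      (ho.mono fun q hq => hq w) ζ
    simp [fderivInnerCLM_apply] at this
    linarith
  have hw := spaceDeriv_patchWeingarten h
  refine
    { symm := hsymm.self_of_nhds
      symm_normal :=
        h.contDiffAt_normal.self_of_nhds.isSymmSndFDerivAt (by simpa using two_le_smooth)
      symm_third := fun θ ζ η => ?_
      unit := h.unit.self_of_nhds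
      unit_deriv := hud.self_of_nhds
      unit_deriv_two := fun ζ η => ?_
      orthogonal := h.orthogonal.self_of_nhds
      orthogonal_deriv := hod.self_of_nhds
      orthogonal_deriv_two := fun η ζ w => ?_
      weingarten := hw.self_of_nhds
      weingarten_deriv := fun ζ v => ?_ }
  · have := HasFDerivAt.eq_zero_of_eventually
      (((hF3.clm_apply (hasFDerivAt_const ζ z)).clm_apply (hasFDerivAt_const η z)).sub
      ((hF3.clm_apply (hasFDerivAt_const η z)).clm_apply (hasFDerivAt_const ζ z)))
      (hsymm.mono fun q hq => sub_eq_zero.2 (hq ζ η)) θ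
    simpa [sub_eq_zero] using this
  · have := HasFDerivAt.eq_zero_of_eventually
      (hN1.self_of_nhds.inner ℝ (hN2.clm_apply (hasFDerivAt_const η z)))
      (hud.mono fun q hq => hq η) ζ
    simp [fderivInnerCLM_apply] at this
    linarith
  · have := HasFDerivAt.eq_zero_of_eventually
      (((hN2.clm_apply (hasFDerivAt_const ζ z)).inner ℝ
        (hF2.self_of_nhds.clm_apply (hasFDerivAt_const ((0, w) : ℝ × Euc m) z))).add
      (hN1.self_of_nhds.inner ℝ ((hF3.clm_apply (hasFDerivAt_const ζ z)).clm_apply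
        (hasFDerivAt_const ((0, w) : ℝ × Euc m) z))))
      (hod.mono fun q hq => hq ζ w) η
    simp [fderivInnerCLM_apply] at this
    linarith
  · have h0 : HasFDerivAt (fun p => ContinuousLinearMap.inr ℝ ℝ (Euc m) (patchWeingarten F N p v))
        ((ContinuousLinearMap.inr ℝ ℝ (Euc m)).comp
          ((fderiv ℝ (patchWeingarten F N) z).flip v)) z := by
      refine (ContinuousLinearMap.inr ℝ ℝ (Euc m)).hasFDerivAt.comp z ?_
      simpa using hL.clm_apply (hasFDerivAt_const v z)
    have := HasFDerivAt.eq_zero_of_eventually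
      ((hN2.clm_apply (hasFDerivAt_const ((0, v) : ℝ × Euc m) z)).add
      (hF2.self_of_nhds.clm_apply h0)) (c := 0) (hw.mono fun q hq => by
        rw [Pi.add_apply, ← eq_neg_iff_add_eq_zero]
        exact hq v) ζ
    simp at this
    rw [eq_sub_iff_add_eq, eq_neg_iff_add_eq_zero, ← this]
    abel

/-- The first variation of the Weingarten map. Here `K` are the Christoffel symbols of the second
kind, `X` is the tangential part of the velocity, and `A` its normal part. -/
theorem PatchIdentities.fderiv_patchWeingarten {F N : ℝ × Euc m → V} {z : ℝ × Euc m}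
    (h : PatchIdentities F N z) (hi : Function.Injective (spaceDeriv F z)) {A : ℝ} {X : Euc m}
    (hX : fderiv ℝ F z (1, 0) = A • N z + fderiv ℝ F z (0, X))
    {K : Euc m →L[ℝ] Euc m →L[ℝ] Euc m}
    (hK : ∀ v w u, ⟪fderiv ℝ F z (0, K v w), fderiv ℝ F z (0, u)⟫ =
      ⟪fderiv ℝ (fderiv ℝ F) z (0, v) (0, w), fderiv ℝ F z (0, u)⟫)
    (hs : ∀ u, ⟪u, N z⟫ = 0 → (∀ w, ⟪u, spaceDeriv F z w⟫ = 0) → u = 0)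
    {H : Euc m →L[ℝ] Euc m →L[ℝ] ℝ}
    (hH : ∀ v w, H v w =
      ⟪fderiv ℝ (fderiv ℝ (fderiv ℝ F)) z (0, v) (0, w) (1, 0), N z⟫ +
        ⟪fderiv ℝ (fderiv ℝ F) z (0, w) (1, 0), fderiv ℝ N z (0, v)⟫ +
        ⟪fderiv ℝ (fderiv ℝ F) z (0, v) (1, 0), fderiv ℝ N z (0, w)⟫ +
        ⟪fderiv ℝ F z (1, 0), fderiv ℝ (fderiv ℝ N) z (0, v) (0, w)⟫ -
        (⟪fderiv ℝ (fderiv ℝ F) z (0, K v w) (1, 0), N z⟫ +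
          ⟪fderiv ℝ F z (1, 0), fderiv ℝ N z (0, K v w)⟫)) :
    ∃ R : Euc m →L[ℝ] Euc m, fderiv ℝ (patchWeingarten F N) z (1, 0) =
      (sharp (gram (spaceDeriv F z) (spaceDeriv F z))).comp H +
        A • (patchWeingarten F N z).comp (patchWeingarten F N z) +
        fderiv ℝ (patchWeingarten F N) z (0, X) +
        ((patchWeingarten F N z).comp R - R.comp (patchWeingarten F N z)) := by
  set g := gram (spaceDeriv F z) (spaceDeriv F z) with hg
  have hinv : g.IsInvertible := isInvertible_gram hi
  have hgs : ∀ v w, g v w = g w v := fun v w => real_inner_comm _ _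
  set L := patchWeingarten F N z with hL
  -- `P` is the tangential part of the derivative of the velocity
  let P : Euc m →L[ℝ] Euc m := (sharp g).comp (gram
    ((fderiv ℝ (fderiv ℝ F) z (1, 0)).comp (ContinuousLinearMap.inr ℝ ℝ (Euc m)))
    (spaceDeriv F z))
  have hgP : ∀ v w, g (P v) w =
      ⟪fderiv ℝ (fderiv ℝ F) z (1, 0) (0, v), fderiv ℝ F z (0, w)⟫ := by
    intro v w
    simp only [P, ContinuousLinearMap.comp_apply]
    rw [sharp_apply hinv]
    simp [gram_apply, spaceDeriv]
  have hgF : ∀ v w, g v w = ⟪fderiv ℝ F z (0, v), fderiv ℝ F z (0, w)⟫ := by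
    intro v w
    simp [hg, gram_apply, spaceDeriv]
  have hNF : ∀ w, ⟪N z, fderiv ℝ F z (0, w)⟫ = 0 := h.orthogonal
  -- Gauss splitting: a vector is its normal component plus the tangent vector with the same inner
  -- products against the tangent space.
  have hsplit : ∀ (u : V) (b : Euc m),
      (∀ w, ⟪fderiv ℝ F z (0, b), fderiv ℝ F z (0, w)⟫ = ⟪u, fderiv ℝ F z (0, w)⟫) →
      u = ⟪u, N z⟫ • N z + fderiv ℝ F z (0, b) := by
    intro u b hb
    rw [← sub_eq_zero]
    apply hs
    · rw [inner_sub_left, inner_add_left, inner_smul_left, h.unit,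
        real_inner_comm (N z) (fderiv ℝ F z (0, b)), hNF]
      simp
    · intro w
      have hw : spaceDeriv F z w = fderiv ℝ F z (0, w) := by simp [spaceDeriv]
      rw [hw, inner_sub_left, inner_add_left, inner_smul_left, hNF, hb]
      simp
  have hFK := fun v w => hsplit (fderiv ℝ (fderiv ℝ F) z (0, v) (0, w)) (K v w) (hK v w)
  have hFP := fun v => hsplit (fderiv ℝ (fderiv ℝ F) z (1, 0) (0, v)) (P v) fun w => by
    rw [← hgP, hgF]
  have hNN : ∀ ζ, ⟪fderiv ℝ N z ζ, N z⟫ = 0 := fun ζ => by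
    rw [real_inner_comm, h.unit_deriv]
  -- inner products with second derivatives reduce to the metric
  have hW := h.weingarten
  have hgNF : ∀ v w, ⟪fderiv ℝ N z (0, v), fderiv ℝ F z (0, w)⟫ = -g (L v) w := fun v w => by
    rw [hW, inner_neg_left, hgF]
  -- Self-adjointness of `L` comes from the symmetry of `∂ᵥ∂_wF`, since `⟪N, ∂ᵥ∂_wF⟫ = g(L v, w)`.
  have hLs : ∀ v w, g (L v) w = g v (L w) := fun v w => by
    have h1 := h.orthogonal_deriv (0, v) w
    have h2 := h.orthogonal_deriv (0, w) v
    rw [hgNF] at h1 h2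
    rw [h.symm] at h1
    rw [hgs v]
    linarith
  have hN1K : ∀ ζ v w, ⟪fderiv ℝ N z ζ, fderiv ℝ (fderiv ℝ F) z (0, v) (0, w)⟫ =
      ⟪fderiv ℝ N z ζ, fderiv ℝ F z (0, K v w)⟫ := fun ζ v w => by
    conv_lhs => rw [hFK, inner_add_right, inner_smul_right, hNN]
    simp
  have hKs : ∀ v w u, g (K v w) u = g (K w v) u := fun v w u => by
    rw [hgF, hgF, hK, hK, h.symm]
  have hL' : ∀ ζ v w, g (fderiv ℝ (patchWeingarten F N) z ζ v) w =
      -⟪fderiv ℝ (fderiv ℝ N) z ζ (0, v), fderiv ℝ F z (0, w)⟫ -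
        ⟪fderiv ℝ (fderiv ℝ F) z ζ (0, L v), fderiv ℝ F z (0, w)⟫ := fun ζ v w => by
    rw [h.weingarten_deriv ζ v, inner_sub_left, inner_neg_left, hgF]
    ring
  -- Only the value of `X` at the point enters. The derivative of the tangential velocity is encoded
  -- by `P - K X`, up to the multiple `-A L` of `L`, which commutes with `L`.
  refine ⟨P - K X, ?_⟩
  ext1 v
  apply hinv.injective
  ext w
  have hsharp : g (sharp g (H v)) w = H v w := by rw [sharp_apply hinv]
  have t1 := h.orthogonal_deriv_two (0, v) (1, 0) w
  have t2 := h.orthogonal_deriv_two (0, v) (0, X) w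
  have t3 := h.orthogonal_deriv_two (0, v) (0, w) X
  have t4 := h.orthogonal_deriv (1, 0) (K v w)
  have t5 := h.unit_deriv_two (0, v) (0, w)
  -- After these rewrites `t1` shares its third derivative of `F` with `H`. Likewise `t2` and `t3`
  -- share theirs, and their difference acts as the Codazzi equation, exchanging `w` and `X`.
  rw [h.symm_third, h.symm_normal, hN1K] at t1
  rw [hN1K, hgNF, h.symm_third, h.symm_normal (0, v)] at t2
  rw [hN1K, hgNF, h.symm (0, w) (0, X)] at t3
  have t6 : ⟪fderiv ℝ F z (1, 0), fderiv ℝ (fderiv ℝ N) z (0, v) (0, w)⟫ =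
      A * ⟪N z, fderiv ℝ (fderiv ℝ N) z (0, v) (0, w)⟫ +
        ⟪fderiv ℝ (fderiv ℝ N) z (0, v) (0, w), fderiv ℝ F z (0, X)⟫ := by
    rw [hX, inner_add_left, inner_smul_left,
      real_inner_comm (fderiv ℝ (fderiv ℝ N) z (0, v) (0, w)) (fderiv ℝ F z (0, X))]
    simp
  have t7 : ⟪fderiv ℝ F z (1, 0), fderiv ℝ N z (0, K v w)⟫ = -g (L X) (K v w) := by
    rw [hX, inner_add_left, inner_smul_left, h.unit_deriv, real_inner_comm, hgNF, hLs, hgs]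
    simp
  have t8 : ⟪fderiv ℝ (fderiv ℝ F) z (0, v) (1, 0), fderiv ℝ N z (0, w)⟫ = -g (P v) (L w) := by
    rw [h.symm, hW, inner_neg_right, ← hgP]
  have t9 : ⟪fderiv ℝ N z (0, v), fderiv ℝ N z (0, w)⟫ = g (L v) (L w) := by
    rw [hW v, hW w, inner_neg_neg, hgF]
  have t10 : ⟪fderiv ℝ (fderiv ℝ F) z (0, w) (1, 0), fderiv ℝ N z (0, v)⟫ =
      ⟪fderiv ℝ N z (0, v), fderiv ℝ (fderiv ℝ F) z (1, 0) (0, w)⟫ := by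
    rw [h.symm, real_inner_comm]
  have t11 : ⟪fderiv ℝ (fderiv ℝ F) z (0, K v w) (1, 0), N z⟫ =
      ⟪N z, fderiv ℝ (fderiv ℝ F) z (1, 0) (0, K v w)⟫ := by
    rw [h.symm, real_inner_comm]
  have t12 := hL' (1, 0) v w
  have t13 := hL' (0, X) v w
  rw [← hgP] at t12
  rw [← hK, ← hgF] at t13
  have t14 := hLs (P v) w
  have t15 := hLs (L v) w
  have t16 := hLs (K X v) w
  have t17 := hKs v X (L w)
  have t18 := hgs (L w) (K v X)
  have t19 : ⟪fderiv ℝ (fderiv ℝ (fderiv ℝ F)) z (0, v) (0, w) (1, 0), N z⟫ =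
      ⟪N z, fderiv ℝ (fderiv ℝ (fderiv ℝ F)) z (0, v) (0, w) (1, 0)⟫ := real_inner_comm _ _
  -- From `⟪N, ∂ᵥ∂_wN⟫ = -⟪∂ᵥN, ∂_wN⟫`; this is the source of the term `A L²`.
  have t20 : ⟪N z, fderiv ℝ (fderiv ℝ N) z (0, v) (0, w)⟫ = -g (L (L v)) w := by
    linarith
  have hHvw := hH v w
  rw [t6, t20, t7, t8, t10, t11, t19] at hHvw
  simp only [add_apply, sub_apply, map_add, map_sub,
    smul_apply, map_smul, ContinuousLinearMap.comp_apply, smul_eq_mul, hsharp]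
  linarith

end Patch

/-- Jacobi's formula. -/
theorem fderiv_det {m : ℕ} (A B : Euc m →L[ℝ] Euc m) :
    fderiv ℝ (fun A : Euc m →L[ℝ] Euc m => LinearMap.det (A : Euc m →ₗ[ℝ] Euc m)) A B =
      LinearMap.trace ℝ (Euc m) (((classicalAdjoint A).comp B : Euc m →L[ℝ] Euc m) :
        Euc m →ₗ[ℝ] Euc m) := by
  -- The determinant is differentiable, so its derivative in direction `B` can be read off along the
  -- line `A + s B`.
  have h1 : HasDerivAt (fun s : ℝ => A + s • B) B 0 := by
    simpa using ((hasDerivAt_id (0 : ℝ)).smul_const B).const_add A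
  have h0 : A + (0 : ℝ) • B = A := by ext1 v; simp
  have h2 := hasDerivAt_det h1
  have h3 := ((contDiff_det (m := m) (n := 1)).differentiable (by simp)
    (A + (0 : ℝ) • B)).hasFDerivAt.comp_hasDerivAt (0 : ℝ) h1
  rw [h0] at h2 h3
  exact h3.unique h2

/-! ### First variation of the Gauß curvature of a patch -/

section PatchVariation

variable {m : ℕ} {V : Type*} [NormedAddCommGroup V] [InnerProductSpace ℝ V]

theorem HasFDerivAt.comp_zero_prodMk {W : Type*} [NormedAddCommGroup W] [NormedSpace ℝ W]
    {f : ℝ × Euc m → W} {f' : ℝ × Euc m →L[ℝ] W} {t : ℝ} {y : Euc m}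
    (h : HasFDerivAt f f' (t, y)) :
    HasFDerivAt (fun y' => f (t, y')) (f'.comp (ContinuousLinearMap.inr ℝ ℝ (Euc m))) y :=
  h.comp y (hasFDerivAt_prodMk_right t y)

/-- The Christoffel symbols of the first kind of the metric `⟪∂ᵢF, ∂ⱼF⟫` are `⟪∂ᵢ∂ⱼF, ∂ₖF⟫`. -/
theorem christoffelCombination_gram {F : ℝ × Euc m → V} {t : ℝ} {y : Euc m}
    (hF : ContDiffAt ℝ ∞ F (t, y)) (v w u : Euc m) :
    christoffelCombination (fderiv ℝ (fun y' => gram (spaceDeriv F (t, y')) (spaceDeriv F (t, y')))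
      y) v w u =
      ⟪fderiv ℝ (fderiv ℝ F) (t, y) (0, v) (0, w), fderiv ℝ F (t, y) (0, u)⟫ := by
  have hF2 : HasFDerivAt (fderiv ℝ F) (fderiv ℝ (fderiv ℝ F) (t, y)) (t, y) :=
    ((hF.fderiv_right (m := ∞) (by simp)).differentiableAt (by simp)).hasFDerivAt
  have hG : HasFDerivAt (fun y' => gram (spaceDeriv F (t, y')) (spaceDeriv F (t, y')))
      (fderiv ℝ (fun y' => gram (spaceDeriv F (t, y')) (spaceDeriv F (t, y'))) y) y := by
    have h0 := (contDiffAt_gram (contDiffAt_spaceDeriv hF) (contDiffAt_spaceDeriv hF)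
      ).differentiableAt (by simp)
    exact (HasFDerivAt.comp_zero_prodMk h0.hasFDerivAt).differentiableAt.hasFDerivAt
  -- Product rule for `⟪∂_wF, ∂ᵤF⟫`. In the Christoffel combination four of the six resulting terms
  -- cancel by symmetry of second derivatives.
  have key : ∀ v w u : Euc m,
      fderiv ℝ (fun y' => gram (spaceDeriv F (t, y')) (spaceDeriv F (t, y'))) y v w u =
        ⟪fderiv ℝ F (t, y) (0, w), fderiv ℝ (fderiv ℝ F) (t, y) (0, v) (0, u)⟫ +
        ⟪fderiv ℝ (fderiv ℝ F) (t, y) (0, v) (0, w), fderiv ℝ F (t, y) (0, u)⟫ := by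
    intro v w u
    have h1 := (hG.clm_apply (hasFDerivAt_const w y)).clm_apply (hasFDerivAt_const u y)
    have h2 := HasFDerivAt.comp_zero_prodMk
      ((hF2.clm_apply (hasFDerivAt_const ((0, w) : ℝ × Euc m) (t, y))).inner ℝ
        (hF2.clm_apply (hasFDerivAt_const ((0, u) : ℝ × Euc m) (t, y))))
    have h3 := congrArg (fun T : Euc m →L[ℝ] ℝ => T v) (h1.unique (h2.congr_of_eventuallyEq
      (Filter.Eventually.of_forall fun q => by simp [gram_apply, spaceDeriv])))
    simpa [fderivInnerCLM_apply] using h3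
  have hsymm := hF.isSymmSndFDerivAt (by simpa using two_le_smooth)
  rw [christoffelCombination_apply, key, key, key, hsymm.eq (0, w) (0, v),
    hsymm.eq (0, u) (0, v), hsymm.eq (0, u) (0, w),
    real_inner_comm _ (fderiv ℝ F (t, y) (0, v)), real_inner_comm _ (fderiv ℝ F (t, y) (0, w))]
  ring

/-- The first variation of the Gauß curvature of a family of hypersurface patches. -/
theorem IsPatchFamilyAt.hasDerivAt_det {F N : ℝ × Euc m → V} {y : Euc m}
    (h : IsPatchFamilyAt F N (0, y)) {H : Euc m →L[ℝ] Euc m →L[ℝ] ℝ}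
    (hH : ∀ v w, H v w =
      fderiv ℝ (fderiv ℝ fun y' => ⟪fderiv ℝ F (0, y') (1, 0), N (0, y')⟫) y v w -
      fderiv ℝ (fun y' => ⟪fderiv ℝ F (0, y') (1, 0), N (0, y')⟫) y
        (sharp (gram (spaceDeriv F (0, y)) (spaceDeriv F (0, y)))
          (christoffelCombination (fderiv ℝ
            (fun y' => gram (spaceDeriv F (0, y')) (spaceDeriv F (0, y'))) y) v w))) :
    HasDerivAt (fun t => LinearMap.det (patchWeingarten F N (t, y) : Euc m →ₗ[ℝ] Euc m))
      (LinearMap.trace ℝ (Euc m) (patchWeingarten F N (0, y) : Euc m →ₗ[ℝ] Euc m) *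
          LinearMap.det (patchWeingarten F N (0, y) : Euc m →ₗ[ℝ] Euc m) *
          ⟪fderiv ℝ F (0, y) (1, 0), N (0, y)⟫ +
        tensorInner (gram (spaceDeriv F (0, y)) (spaceDeriv F (0, y)))
          ((gram (spaceDeriv F (0, y)) (spaceDeriv F (0, y))).comp
            (classicalAdjoint (patchWeingarten F N (0, y)))) H +
        fderiv ℝ (fun y' => LinearMap.det (patchWeingarten F N (0, y') : Euc m →ₗ[ℝ] Euc m)) y
          (sharp (gram (spaceDeriv F (0, y)) (spaceDeriv F (0, y)))
            ((innerSL ℝ (fderiv ℝ F (0, y) (1, 0))).comp (spaceDeriv F (0, y))))) 0 := by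
  have hid := h.identities
  have hi := h.injective.self_of_nhds
  have hs := h.spanning.self_of_nhds
  have hcF := h.contDiffAt.self_of_nhds
  have hcN := h.contDiffAt_normal.self_of_nhds
  set g := gram (spaceDeriv F (0, y)) (spaceDeriv F (0, y)) with hg
  have hinv : g.IsInvertible := isInvertible_gram hi
  have hgs : ∀ v w, g v w = g w v := fun v w => real_inner_comm _ _
  have hgF : ∀ v w, g v w = ⟪fderiv ℝ F (0, y) (0, v), fderiv ℝ F (0, y) (0, w)⟫ := by
    intro v w
    simp [hg, gram_apply, spaceDeriv]
  set L := patchWeingarten F N (0, y) with hL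
  set A := ⟪fderiv ℝ F (0, y) (1, 0), N (0, y)⟫ with hA
  set X := sharp g ((innerSL ℝ (fderiv ℝ F (0, y) (1, 0))).comp (spaceDeriv F (0, y))) with hXdef
  set G' := christoffelCombination (fderiv ℝ
    (fun y' => gram (spaceDeriv F (0, y')) (spaceDeriv F (0, y'))) y) with hG'
  have hX : fderiv ℝ F (0, y) (1, 0) = A • N (0, y) + fderiv ℝ F (0, y) (0, X) := by
    rw [← sub_eq_zero]
    apply hs
    · rw [inner_sub_left, inner_add_left, inner_smul_left, hid.unit,
        real_inner_comm (N (0, y)) (fderiv ℝ F (0, y) (0, X)), hid.orthogonal]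
      simp [hA]
    · intro w
      have hw : spaceDeriv F (0, y) w = fderiv ℝ F (0, y) (0, w) := by simp [spaceDeriv]
      rw [inner_sub_left, inner_add_left, inner_smul_left, hw, hid.orthogonal, ← hgF, hXdef,
        sharp_apply hinv]
      simp [hw]
  let K : Euc m →L[ℝ] Euc m →L[ℝ] Euc m :=
    (ContinuousLinearMap.compL ℝ (Euc m) (Euc m →L[ℝ] ℝ) (Euc m) (sharp g)).comp G'
  have hKdef : ∀ v w, K v w = sharp g (G' v w) := fun v w => rfl
  have hK : ∀ v w u, ⟪fderiv ℝ F (0, y) (0, K v w), fderiv ℝ F (0, y) (0, u)⟫ =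
      ⟪fderiv ℝ (fderiv ℝ F) (0, y) (0, v) (0, w), fderiv ℝ F (0, y) (0, u)⟫ := by
    intro v w u
    rw [← hgF, hKdef, sharp_apply hinv, hG', christoffelCombination_gram hcF]
  -- the derivatives of the normal velocity
  have hd1 : ∀ᶠ y' in 𝓝 y, ∀ v,
      fderiv ℝ (fun y' => ⟪fderiv ℝ F (0, y') (1, 0), N (0, y')⟫) y' v =
        ⟪fderiv ℝ (fderiv ℝ F) (0, y') (0, v) (1, 0), N (0, y')⟫ +
          ⟪fderiv ℝ F (0, y') (1, 0), fderiv ℝ N (0, y') (0, v)⟫ := by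
    have hc : Filter.Tendsto (fun y' : Euc m => ((0 : ℝ), y')) (𝓝 y) (𝓝 (0, y)) :=
      (Continuous.prodMk_right (0 : ℝ)).continuousAt
    filter_upwards [hc.eventually h.contDiffAt, hc.eventually h.contDiffAt_normal]
      with y' hF hN v
    have hF2 := ((hF.fderiv_right (m := ∞) (by simp)).differentiableAt (by simp)).hasFDerivAt
    have hN1 := (hN.differentiableAt (by simp)).hasFDerivAt
    have h2 := HasFDerivAt.comp_zero_prodMk
      ((hF2.clm_apply (hasFDerivAt_const ((1, 0) : ℝ × Euc m) (0, y'))).inner ℝ hN1)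
    rw [h2.fderiv]
    simp [fderivInnerCLM_apply]
    ring
  have hda : ContDiffAt ℝ ∞ (fun y' => ⟪fderiv ℝ F (0, y') (1, 0), N (0, y')⟫) y := by
    have h3 : ContDiffAt ℝ ∞ (fun p => ⟪fderiv ℝ F p (1, 0), N p⟫) (0, y) :=
      ((hcF.fderiv_right (m := ∞) (by simp)).clm_apply contDiffAt_const).inner ℝ hcN
    exact h3.comp y (contDiff_prodMk_right (0 : ℝ)).contDiffAt
  have hd2 : ∀ v w, fderiv ℝ (fderiv ℝ fun y' => ⟪fderiv ℝ F (0, y') (1, 0), N (0, y')⟫) y v w =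
      ⟪fderiv ℝ (fderiv ℝ (fderiv ℝ F)) (0, y) (0, v) (0, w) (1, 0), N (0, y)⟫ +
        ⟪fderiv ℝ (fderiv ℝ F) (0, y) (0, w) (1, 0), fderiv ℝ N (0, y) (0, v)⟫ +
        ⟪fderiv ℝ (fderiv ℝ F) (0, y) (0, v) (1, 0), fderiv ℝ N (0, y) (0, w)⟫ +
        ⟪fderiv ℝ F (0, y) (1, 0), fderiv ℝ (fderiv ℝ N) (0, y) (0, v) (0, w)⟫ := by
    intro v w
    have hF2 := ((hcF.fderiv_right (m := ∞) (by simp)).differentiableAt (by simp)).hasFDerivAt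
    have hF3 := (((hcF.fderiv_right (m := ∞) (by simp)).fderiv_right
      (m := ∞) (by simp)).differentiableAt (by simp)).hasFDerivAt
    have hN1 := (hcN.differentiableAt (by simp)).hasFDerivAt
    have hN2 := ((hcN.fderiv_right (m := ∞) (by simp)).differentiableAt (by simp)).hasFDerivAt
    have h2 := HasFDerivAt.comp_zero_prodMk
      ((((hF3.clm_apply (hasFDerivAt_const ((0, w) : ℝ × Euc m) (0, y))).clm_apply
        (hasFDerivAt_const ((1, 0) : ℝ × Euc m) (0, y))).inner ℝ hN1).add
      ((hF2.clm_apply (hasFDerivAt_const ((1, 0) : ℝ × Euc m) (0, y))).inner ℝ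
        (hN2.clm_apply (hasFDerivAt_const ((0, w) : ℝ × Euc m) (0, y)))))
    have h4 := ((hda.fderiv_right (m := ∞) (by simp)).differentiableAt
      (by simp)).hasFDerivAt.clm_apply (hasFDerivAt_const w y)
    have h5 := congrArg (fun T : Euc m →L[ℝ] ℝ => T v) (h4.unique (h2.congr_of_eventuallyEq
      (hd1.mono fun q hq => hq w)))
    simp [fderivInnerCLM_apply] at h5
    rw [h5]
    ring
  have hH' := fun v w => (hH v w).trans (by rw [hd2, hd1.self_of_nhds, ← hKdef])
  obtain ⟨R, hR⟩ := hid.fderiv_patchWeingarten hi hX hK hs hH'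
  -- Symmetry of the Hessian, required to rewrite `g⁰₂` as a trace: the Christoffel symbols are
  -- symmetric because `∂ᵥ∂_wF` is.
  have hHs : ∀ v w, H v w = H w v := by
    intro v w
    have hKs : K v w = K w v := by
      apply hinv.injective
      ext u
      rw [hgF, hgF, hK, hK, hid.symm]
    rw [hH, hH, ← hKdef, ← hKdef, hKs,
      (hda.isSymmSndFDerivAt (by simpa using two_le_smooth)).eq v w]
  have hW := ((contDiffAt_patchWeingarten hcF hcN hi).differentiableAt (by simp)).hasFDerivAt
  have hWt : HasDerivAt (fun t => patchWeingarten F N (t, y))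
      (fderiv ℝ (patchWeingarten F N) (0, y) (1, 0)) 0 := by
    refine (hW.comp_hasDerivAt (0 : ℝ) (f := fun t => (t, y)) (f' := (1, 0)) ?_)
    exact (hasDerivAt_id (0 : ℝ)).prodMk (hasDerivAt_const _ _)
  have hdet : fderiv ℝ (fun y' => LinearMap.det
      (patchWeingarten F N (0, y') : Euc m →ₗ[ℝ] Euc m)) y X =
      LinearMap.trace ℝ (Euc m) (((classicalAdjoint L).comp
        (fderiv ℝ (patchWeingarten F N) (0, y) (0, X)) : Euc m →L[ℝ] Euc m) :
          Euc m →ₗ[ℝ] Euc m) := by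
    rw [← fderiv_det]
    have hdet' := ((contDiff_det (m := m) (n := 1)).differentiable (by simp) L).hasFDerivAt
    have h1 := hdet'.comp y (HasFDerivAt.comp_zero_prodMk hW)
    rw [show (fun y' => LinearMap.det (patchWeingarten F N (0, y') : Euc m →ₗ[ℝ] Euc m)) =
      (fun A : Euc m →L[ℝ] Euc m => LinearMap.det (A : Euc m →ₗ[ℝ] Euc m)) ∘
        fun y' => patchWeingarten F N (0, y') from rfl, h1.fderiv]
    simp
  -- Jacobi's formula in `t`; the four terms of `hR` are then traced against the classical adjoint.
  refine (HypersurfaceVariation.hasDerivAt_det hWt).congr_deriv ?_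
  rw [hdet, tensorInner_comp hinv hgs _ hHs, hR]
  simp only [ContinuousLinearMap.comp_add, ContinuousLinearMap.toLinearMap_add, map_add,
    ContinuousLinearMap.comp_smul, ContinuousLinearMap.toLinearMap_smul, map_smul]
  rw [← hL, trace_classicalAdjoint_comp_commutator, trace_classicalAdjoint_comp_sq, smul_eq_mul]
  ring

end PatchVariation

/-! ### The unit normal as a normalized cross product -/

section UnitNormal

variable {m : ℕ} {M : Type*} [TopologicalSpace M] [ChartedSpace (Euc m) M]

theorem inner_cross_comp_basis (A : Euc m →L[ℝ] Euc (m + 1)) (b b' : Module.Basis (Fin m) ℝ (Euc m))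
    (v : Euc (m + 1)) :
    (EuclideanSpace.basisFun (Fin (m + 1)) ℝ).toBasis.det
      (Matrix.vecCons v (fun i => A (b' i))) = b.det b' * ⟪v, cross (fun i => A (b i))⟫ := by
  rw [← inner_cross, cross_comp_basis A b b', inner_smul_right]

theorem cross_comp_ne_zero {A : Euc m →L[ℝ] Euc (m + 1)} (hA : Function.Injective A)
    (b : Module.Basis (Fin m) ℝ (Euc m)) : cross (fun i => A (b i)) ≠ 0 :=
  cross_ne_zero (b.linearIndependent.map' (A : Euc m →ₗ[ℝ] Euc (m + 1))
    (LinearMap.ker_eq_bot.2 hA))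

theorem inner_cross_comp (A : Euc m →L[ℝ] Euc (m + 1)) (b : Module.Basis (Fin m) ℝ (Euc m))
    (w : Euc m) : ⟪cross (fun i => A (b i)), A w⟫ = 0 := by
  have h : ((innerSL ℝ (cross (fun i => A (b i)))).comp A : Euc m →ₗ[ℝ] ℝ) = 0 :=
    b.ext fun i => by
      simp only [ContinuousLinearMap.coe_coe, ContinuousLinearMap.comp_apply, innerSL_apply_apply,
        LinearMap.zero_apply]
      rw [real_inner_comm, inner_cross_self (fun i => A (b i))]
  exact congrArg (fun T : Euc m →ₗ[ℝ] ℝ => T w) h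

/-- The positively oriented unit vector orthogonal to a hyperplane is the normalized cross product
of the images of the vectors of a positively oriented basis. -/
theorem unit_orthogonal_positive_iff {A : Euc m →L[ℝ] Euc (m + 1)} (hA : Function.Injective A)
    {o : Orientation ℝ (Euc m) (Fin m)} {ε : ℝ} (b : Module.Basis (Fin m) ℝ (Euc m))
    (hb : ε = 1 ∧ b.orientation = o ∨ ε = -1 ∧ b.orientation = -o) (v : Euc (m + 1)) :
    (‖v‖ = 1 ∧ (∀ w, ⟪v, A w⟫ = 0) ∧ ∀ b' : Module.Basis (Fin m) ℝ (Euc m),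
      0 < (EuclideanSpace.basisFun (Fin (m + 1)) ℝ).toBasis.det
        (Matrix.vecCons v (fun i => A (b' i))) ↔ b'.orientation = o) ↔
      v = (ε * ‖cross (fun i => A (b i))‖⁻¹) • cross (fun i => A (b i)) := by
  set c := cross (fun i => A (b i)) with hc
  have hc0 : c ≠ 0 := cross_comp_ne_zero hA b
  have hcn : 0 < ‖c‖ := norm_pos_iff.2 hc0
  have hεa : |ε| = 1 := by rcases hb with h | h <;> rw [h.1] <;> norm_num
  constructor
  · intro h
    have hv : v = (⟪v, c⟫ / ‖c‖ ^ 2) • c := by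
      rw [← sub_eq_zero]
      apply eq_zero_of_inner_cross hc0
      · rw [← hc, inner_sub_left, inner_smul_left, real_inner_self_eq_norm_sq]
        simp [hc0]
      · intro i
        rw [inner_sub_left, inner_smul_left, h.2.1, hc, inner_cross_comp]
        simp
    have hpos := h.2.2 b
    rw [← inner_cross, ← hc] at hpos
    have hn := h.1
    rw [hv, norm_smul, norm_div, norm_pow, norm_norm, Real.norm_eq_abs] at hn
    have habs : |⟪v, c⟫| = ‖c‖ := by
      field_simp at hn
      exact hn
    have hk : ⟪v, c⟫ = ε * ‖c‖ := by
      rcases hb with ⟨h1, h2⟩ | ⟨h1, h2⟩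
      · rw [h1, one_mul, ← habs, abs_of_pos (hpos.2 h2)]
      -- For a negative basis only `⟪v, c⟫ ≤ 0` is known at first; together with `|⟪v, c⟫| = ‖c‖`
      -- this fixes the value.
      · have h3 : ¬ 0 < ⟪v, c⟫ := fun h4 => by
          have h5 := hpos.1 h4
          rw [h2] at h5
          exact Module.Ray.ne_neg_self _ h5.symm
        rw [h1, ← habs, abs_of_nonpos (not_lt.1 h3)]
        ring
    rw [hv, hk]
    congr 1
    field_simp
  · intro h
    have hvc : ⟪v, c⟫ = ε * ‖c‖ := by
      rw [h, inner_smul_left, real_inner_self_eq_norm_sq]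
      simp only [conj_trivial]
      field_simp
    refine ⟨?_, fun w => ?_, fun b' => ?_⟩
    · rw [h, norm_smul, norm_mul, norm_inv, norm_norm, Real.norm_eq_abs, hεa]
      field_simp
    · rw [h, inner_smul_left, hc, inner_cross_comp, mul_zero]
    · have h1 := inner_cross_comp_basis (A) b b' v
      rw [h1, ← hc, hvc, ← mul_assoc, mul_pos_iff_of_pos_right hcn]
      have h2 : b.orientation = b'.orientation ↔ 0 < b.det b' :=
        b.orientation_eq_iff_det_pos b'
      rcases hb with ⟨h3, h4⟩ | ⟨h3, h4⟩
      · rw [h3, mul_one, ← h4, ← h2, eq_comm]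
      · have h5 : b.det b' ≠ 0 := (b.isUnit_det b').ne_zero
        have h6 : o = -b.orientation := by rw [h4]; exact (neg_neg (G := Module.Ray ℝ _) o).symm
        rw [h3, h6, ← Module.Basis.orientation_ne_iff_eq_neg, ne_comm, Ne, h2, not_lt]
        constructor
        · intro h7
          linarith
        · intro h7
          have := lt_of_le_of_ne h7 h5
          linarith

variable [IsManifold (𝓡 m) ∞ M]

/-- The defining conditions have exactly one solution, so the choice operator returns it. Allowing
`ε = -1` covers negative coordinate frames, and for `m = 0` the empty basis, which cannot be
reversed. -/
theorem unitNormal_eq {o : ManifoldOrientation m M} {f : M → Euc (m + 1)} {x : M}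
    (hi : Function.Injective (tangentMap m f x)) {ε : ℝ} (b : Module.Basis (Fin m) ℝ (Euc m))
    {b' : Module.Basis (Fin m) ℝ (TangentSpace (𝓡 m) x)} (hbb' : ∀ i, b' i = b i)
    (hb : ε = 1 ∧ b'.orientation = o.at_ x ∨ ε = -1 ∧ b'.orientation = -o.at_ x) :
    unitNormal o f x = (ε * ‖cross (fun i => tangentMap m f x (b i))‖⁻¹) •
      cross (fun i => tangentMap m f x (b i)) := by
  obtain rfl : b' = b := Module.Basis.eq_of_apply_eq hbb'
  have key : ∀ v, IsPositiveUnitNormal o f x v ↔ _ := fun v =>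
    ⟨fun h => (unit_orthogonal_positive_iff hi (o := o.at_ x) b' hb v).1
      ⟨h.norm_eq_one, h.orthogonal, h.positive⟩, fun h => by
      obtain ⟨h1, h2, h3⟩ := (unit_orthogonal_positive_iff hi (o := o.at_ x) b' hb v).2 h
      exact ⟨h1, h2, h3⟩⟩
  exact (key _).1 (Classical.epsilon_spec ⟨_, (key _).2 rfl⟩)

end UnitNormal

/-! ### Coordinate frames and their orientation -/

section Chart

variable {m : ℕ} {M : Type*} [TopologicalSpace M] [ChartedSpace (Euc m) M]

/-- The coordinate frame of the preferred chart at `x₀`: the derivative of its inverse. -/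
def chartFrame (x₀ : M) (y : Euc m) : Euc m →L[ℝ] Euc m :=
  mfderiv 𝓘(ℝ, Euc m) (𝓡 m) (extChartAt (𝓡 m) x₀).symm y

/-- The derivative of the preferred chart at `x₀`. -/
def chartDeriv (x₀ x : M) : Euc m →L[ℝ] Euc m :=
  mfderiv (𝓡 m) 𝓘(ℝ, Euc m) (extChartAt (𝓡 m) x₀) x

theorem target_mem_nhds (x₀ : M) {y : Euc m} (hy : y ∈ (extChartAt (𝓡 m) x₀).target) :
    (extChartAt (𝓡 m) x₀).target ∈ 𝓝 y :=
  (isOpen_extChartAt_target x₀).mem_nhds hy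

variable [IsManifold (𝓡 m) ∞ M]

theorem isManifold_one : IsManifold (𝓡 m) 1 M :=
  IsManifold.of_le (n := ∞) (one_le_two.trans two_le_smooth)

theorem chartFrame_comp_chartDeriv {x₀ : M} {y : Euc m} (hy : y ∈ (extChartAt (𝓡 m) x₀).target) :
    (chartFrame x₀ y).comp (chartDeriv x₀ ((extChartAt (𝓡 m) x₀).symm y)) =
      ContinuousLinearMap.id ℝ (Euc m) := by
  have := isManifold_one (m := m) (M := M)
  have h := mfderivWithin_extChartAt_symm_comp_mfderiv_extChartAt hy
  rw [ModelWithCorners.range_eq_univ, mfderivWithin_univ] at h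
  exact h

theorem chartDeriv_comp_chartFrame {x₀ : M} {y : Euc m} (hy : y ∈ (extChartAt (𝓡 m) x₀).target) :
    (chartDeriv x₀ ((extChartAt (𝓡 m) x₀).symm y)).comp (chartFrame x₀ y) =
      ContinuousLinearMap.id ℝ (Euc m) := by
  have := isManifold_one (m := m) (M := M)
  have h := mfderiv_extChartAt_comp_mfderivWithin_extChartAt_symm hy
  rw [ModelWithCorners.range_eq_univ, mfderivWithin_univ] at h
  exact h

/-- Tangent vectors at `x₀` are by definition given by their components in the preferred chart at
`x₀`. -/
theorem chartFrame_self (x₀ : M) :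
    chartFrame x₀ (extChartAt (𝓡 m) x₀ x₀) = ContinuousLinearMap.id ℝ (Euc m) := by
  have := isManifold_one (m := m) (M := M)
  have h := mfderivWithin_range_extChartAt_symm (I := 𝓡 m) (x := x₀)
  rw [ModelWithCorners.range_eq_univ, mfderivWithin_univ] at h
  exact h

theorem contMDiffAt_symm {x₀ : M} {y : Euc m} (hy : y ∈ (extChartAt (𝓡 m) x₀).target) :
    ContMDiffAt 𝓘(ℝ, Euc m) (𝓡 m) ∞ (extChartAt (𝓡 m) x₀).symm y :=
  (contMDiffOn_extChartAt_symm x₀).contMDiffAt (target_mem_nhds x₀ hy)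

theorem fderiv_comp_symm {k : ℕ} {u : M → Euc k} {x₀ : M} {y : Euc m}
    (hy : y ∈ (extChartAt (𝓡 m) x₀).target)
    (hu : MDifferentiableAt (𝓡 m) 𝓘(ℝ, Euc k) u ((extChartAt (𝓡 m) x₀).symm y)) :
    fderiv ℝ (u ∘ (extChartAt (𝓡 m) x₀).symm) y =
      (tangentMap m u ((extChartAt (𝓡 m) x₀).symm y)).comp (chartFrame x₀ y) := by
  rw [← mfderiv_eq_fderiv, mfderiv_comp y hu
    ((contMDiffAt_symm hy).mdifferentiableAt (by simp))]
  rfl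

/-- The coordinate frame as a basis. -/
def chartBasis (x₀ : M) {y : Euc m} (hy : y ∈ (extChartAt (𝓡 m) x₀).target) :
    Module.Basis (Fin m) ℝ (Euc m) :=
  (EuclideanSpace.basisFun (Fin m) ℝ).toBasis.map
    (ContinuousLinearEquiv.equivOfInverse' (chartFrame x₀ y)
      (chartDeriv x₀ ((extChartAt (𝓡 m) x₀).symm y)) (chartFrame_comp_chartDeriv hy)
      (chartDeriv_comp_chartFrame hy)).toLinearEquiv

theorem chartBasis_apply (x₀ : M) {y : Euc m} (hy : y ∈ (extChartAt (𝓡 m) x₀).target) (i : Fin m) :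
    chartBasis x₀ hy i = chartFrame x₀ y (EuclideanSpace.single i 1) := by
  simp [chartBasis]

theorem chartBasis_det (x₀ : M) {y : Euc m} (hy : y ∈ (extChartAt (𝓡 m) x₀).target)
    (v : Fin m → Euc m) : (chartBasis x₀ hy).det v =
      (EuclideanSpace.basisFun (Fin m) ℝ).toBasis.det
        (fun i => chartDeriv x₀ ((extChartAt (𝓡 m) x₀).symm y) (v i)) := by
  rw [chartBasis, Module.Basis.det_map]
  rfl

/-- The trivialization of the tangent bundle at `x₀` acts on fibres by the derivative of the chart
at `x₀`, so these are the components of the section in that trivialization. -/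
theorem continuousAt_chartDeriv_apply {s : (x : M) → TangentSpace (𝓡 m) x} {x₀ : M}
    (hs : ContMDiffAt (𝓡 m) ((𝓡 m).prod 𝓘(ℝ, Euc m)) ∞
      (fun x => Bundle.TotalSpace.mk' (Euc m) x (s x)) x₀) :
    ContinuousAt (fun x => chartDeriv x₀ x (s x)) x₀ := by
  have := isManifold_one (m := m) (M := M)
  rw [Bundle.contMDiffAt_section] at hs
  refine hs.continuousAt.congr ?_
  filter_upwards [chart_source_mem_nhds (Euc m) x₀] with x hx
  have h := TangentBundle.continuousLinearMapAt_trivializationAt (I := 𝓡 m) hx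
  have h2 : chartDeriv x₀ x (s x) =
      (trivializationAt (Euc m) (TangentSpace (𝓡 m)) x₀).continuousLinearMapAt ℝ x (s x) := by
    rw [h]; rfl
  rw [h2, Bundle.Trivialization.continuousLinearMapAt_apply,
    Bundle.Trivialization.coe_linearMapAt_of_mem]
  simpa using hx

/-- Near a point, a coordinate frame is everywhere positive or everywhere negative. -/
theorem exists_sign_chartBasis (o : ManifoldOrientation m M) (x₀ : M) :
    ∃ ε : ℝ, (ε = 1 ∨ ε = -1) ∧ ∀ᶠ y in 𝓝 (extChartAt (𝓡 m) x₀ x₀),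
      ∀ hy : y ∈ (extChartAt (𝓡 m) x₀).target,
        ∃ b : Module.Basis (Fin m) ℝ (TangentSpace (𝓡 m) ((extChartAt (𝓡 m) x₀).symm y)),
          (∀ i, b i = chartBasis x₀ hy i) ∧
          (ε = 1 ∧ b.orientation = o.at_ ((extChartAt (𝓡 m) x₀).symm y) ∨
            ε = -1 ∧ b.orientation = -o.at_ ((extChartAt (𝓡 m) x₀).symm y)) := by
  obtain ⟨u, hu, s, hs, hor⟩ := o.exists_frame x₀
  -- The determinant of the given frame relative to the coordinate frame: continuous and nonzero at
  -- `x₀`, hence of constant sign nearby. The sign `ε` combines that of `d` with that of the given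
  -- frame.
  set d : M → ℝ := fun x => (EuclideanSpace.basisFun (Fin m) ℝ).toBasis.det
    (fun i => chartDeriv x₀ x (s i x)) with hd
  have hdc : ContinuousAt d x₀ := by
    have h1 : ∀ i, ContinuousAt (fun x => chartDeriv x₀ x (s i x)) x₀ := fun i =>
      continuousAt_chartDeriv_apply ((hs.contMDiffOn i).contMDiffAt hu)
    simp only [hd, Module.Basis.det_apply]
    refine ContinuousAt.comp (g := Matrix.det) (continuous_id.matrix_det).continuousAt ?_
    refine continuousAt_pi.2 fun j => continuousAt_pi.2 fun i => ?_
    simp only [Module.Basis.toMatrix_apply, OrthonormalBasis.coe_toBasis_repr_apply,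
      EuclideanSpace.basisFun_repr]
    exact (EuclideanSpace.proj j : Euc m →L[ℝ] ℝ).continuous.continuousAt.comp (h1 i)
  have hsymm : Filter.Tendsto (extChartAt (𝓡 m) x₀).symm (𝓝 (extChartAt (𝓡 m) x₀ x₀)) (𝓝 x₀) := by
    have := continuousAt_extChartAt_symm (I := 𝓡 m) x₀
    rw [ContinuousAt, extChartAt_to_inv] at this
    exact this
  -- the determinant of the frame with respect to the coordinate frame
  have hrel : ∀ {y} (hy : y ∈ (extChartAt (𝓡 m) x₀).target)
      (hyu : (extChartAt (𝓡 m) x₀).symm y ∈ u)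
      (b : Module.Basis (Fin m) ℝ (TangentSpace (𝓡 m) ((extChartAt (𝓡 m) x₀).symm y))),
      (∀ i, b i = chartBasis x₀ hy i) →
      b.det (hs.toBasisAt hyu) = d ((extChartAt (𝓡 m) x₀).symm y) := by
    intro y hy hyu b hb
    obtain rfl : b = chartBasis x₀ hy := Module.Basis.eq_of_apply_eq hb
    have h1 : (fun i => hs.toBasisAt hyu i) = fun i => s i ((extChartAt (𝓡 m) x₀).symm y) := by
      funext i
      exact hs.toBasisAt_coe hyu i
    have h2 := chartBasis_det x₀ hy (fun i => s i ((extChartAt (𝓡 m) x₀).symm y))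
    exact (congrArg (chartBasis x₀ hy).det h1).trans h2
  have hd0 : d x₀ ≠ 0 := by
    have h0 : d ((extChartAt (𝓡 m) x₀).symm (extChartAt (𝓡 m) x₀ x₀)) ≠ 0 := by
      have h1 := hrel (mem_extChartAt_target (I := 𝓡 m) x₀)
        (by rw [extChartAt_to_inv]; exact mem_of_mem_nhds hu) (chartBasis x₀ _) (fun _ => rfl)
      rw [← h1]
      exact (Module.Basis.isUnit_det _ _).ne_zero
    rwa [extChartAt_to_inv] at h0
  have hev : ∀ᶠ y in 𝓝 (extChartAt (𝓡 m) x₀ x₀), (extChartAt (𝓡 m) x₀).symm y ∈ u :=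
    hsymm.eventually hu
  rcases lt_or_gt_of_ne hd0 with hneg | hpos
  · have hsign := hsymm.eventually (hdc.eventually (gt_mem_nhds hneg))
    have hopp : ∀ {y} (hy : y ∈ (extChartAt (𝓡 m) x₀).target)
        (hyu : (extChartAt (𝓡 m) x₀).symm y ∈ u),
        d ((extChartAt (𝓡 m) x₀).symm y) < 0 →
        ∃ b : Module.Basis (Fin m) ℝ (TangentSpace (𝓡 m) ((extChartAt (𝓡 m) x₀).symm y)),
          (∀ i, b i = chartBasis x₀ hy i) ∧ b.orientation = -(hs.toBasisAt hyu).orientation := by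
      intro y hy hyu hlt
      obtain ⟨b, hb⟩ : ∃ b : Module.Basis (Fin m) ℝ
          (TangentSpace (𝓡 m) ((extChartAt (𝓡 m) x₀).symm y)), ∀ i, b i = chartBasis x₀ hy i :=
        ⟨chartBasis x₀ hy, fun _ => rfl⟩
      refine ⟨b, hb, ?_⟩
      rw [← Module.Basis.orientation_ne_iff_eq_neg, Ne, Module.Basis.orientation_eq_iff_det_pos,
        hrel hy hyu b hb]
      exact not_lt.2 hlt.le
    rcases hor with hor | hor
    · refine ⟨-1, Or.inr rfl, ?_⟩
      filter_upwards [hev, hsign] with y hyu hlt hy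
      obtain ⟨b, hb, hbo⟩ := hopp hy hyu hlt
      exact ⟨b, hb, Or.inr ⟨rfl, by rw [hbo, hor]⟩⟩
    · refine ⟨1, Or.inl rfl, ?_⟩
      filter_upwards [hev, hsign] with y hyu hlt hy
      obtain ⟨b, hb, hbo⟩ := hopp hy hyu hlt
      refine ⟨b, hb, Or.inl ⟨rfl, ?_⟩⟩
      rw [hbo, hor]
      exact neg_neg (G := Module.Ray ℝ _) (o.at_ _)
  · have hsign := hsymm.eventually (hdc.eventually (lt_mem_nhds hpos))
    have hsame : ∀ {y} (hy : y ∈ (extChartAt (𝓡 m) x₀).target)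
        (hyu : (extChartAt (𝓡 m) x₀).symm y ∈ u),
        0 < d ((extChartAt (𝓡 m) x₀).symm y) →
        ∃ b : Module.Basis (Fin m) ℝ (TangentSpace (𝓡 m) ((extChartAt (𝓡 m) x₀).symm y)),
          (∀ i, b i = chartBasis x₀ hy i) ∧ b.orientation = (hs.toBasisAt hyu).orientation := by
      intro y hy hyu hlt
      obtain ⟨b, hb⟩ : ∃ b : Module.Basis (Fin m) ℝ
          (TangentSpace (𝓡 m) ((extChartAt (𝓡 m) x₀).symm y)), ∀ i, b i = chartBasis x₀ hy i :=
        ⟨chartBasis x₀ hy, fun _ => rfl⟩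
      refine ⟨b, hb, ?_⟩
      rwa [Module.Basis.orientation_eq_iff_det_pos, hrel hy hyu b hb]
    rcases hor with hor | hor
    · refine ⟨1, Or.inl rfl, ?_⟩
      filter_upwards [hev, hsign] with y hyu hlt hy
      obtain ⟨b, hb, hbo⟩ := hsame hy hyu hlt
      exact ⟨b, hb, Or.inl ⟨rfl, by rw [hbo, hor]⟩⟩
    · refine ⟨-1, Or.inr rfl, ?_⟩
      filter_upwards [hev, hsign] with y hyu hlt hy
      obtain ⟨b, hb, hbo⟩ := hsame hy hyu hlt
      exact ⟨b, hb, Or.inr ⟨rfl, by rw [hbo, hor]⟩⟩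

end Chart

/-! ### From patches in a chart to the manifold -/

section Transport

variable {m : ℕ} {M : Type*} [TopologicalSpace M] [ChartedSpace (Euc m) M]

/-- A family of maps on `M` in the preferred chart at `x₀`. -/
def patch (f : ℝ → M → Euc (m + 1)) (x₀ : M) (z : ℝ × Euc m) : Euc (m + 1) :=
  f z.1 ((extChartAt (𝓡 m) x₀).symm z.2)

/-- The normalized cross product of the coordinate tangent vectors, up to a sign `ε`. -/
def patchNormal (ε : ℝ) (F : ℝ × Euc m → Euc (m + 1)) (z : ℝ × Euc m) : Euc (m + 1) :=
  (ε * ‖cross (fun i => spaceDeriv F z (EuclideanSpace.single i 1))‖⁻¹) •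
    cross (fun i => spaceDeriv F z (EuclideanSpace.single i 1))

theorem spaceDeriv_eq_fderiv {V : Type*} [NormedAddCommGroup V] [InnerProductSpace ℝ V]
    {F : ℝ × Euc m → V} {t : ℝ} {y : Euc m} (hF : DifferentiableAt ℝ F (t, y)) :
    spaceDeriv F (t, y) = fderiv ℝ (fun y' => F (t, y')) y :=
  (HasFDerivAt.comp_zero_prodMk hF.hasFDerivAt).fderiv.symm

theorem cross_single_ne_zero {A : Euc m →L[ℝ] Euc (m + 1)} (hA : Function.Injective A) :
    cross (fun i => A (EuclideanSpace.single i 1)) ≠ 0 := by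
  simpa using cross_comp_ne_zero hA (EuclideanSpace.basisFun (Fin m) ℝ).toBasis

theorem contDiffAt_patchNormal {ε : ℝ} {F : ℝ × Euc m → Euc (m + 1)} {z : ℝ × Euc m}
    (hF : ContDiffAt ℝ ∞ F z) (hi : Function.Injective (spaceDeriv F z)) :
    ContDiffAt ℝ ∞ (patchNormal ε F) z := by
  have h1 : ContDiffAt ℝ ∞ (fun z => cross (fun i => spaceDeriv F z (EuclideanSpace.single i 1)))
      z := by
    refine contDiff_cross.contDiffAt.comp z (contDiffAt_pi.2 fun i => ?_)
    exact (contDiffAt_spaceDeriv hF).clm_apply contDiffAt_const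
  have h0 := cross_single_ne_zero hi
  exact (contDiffAt_const.mul ((h1.norm ℝ h0).inv (norm_ne_zero_iff.2 h0))).smul h1

/-- A family of immersed patches with the normal field given by the cross product. -/
theorem isPatchFamilyAt_patchNormal {ε : ℝ} (hε : ε = 1 ∨ ε = -1) {F : ℝ × Euc m → Euc (m + 1)}
    {z : ℝ × Euc m} (hF : ∀ᶠ p in 𝓝 z, ContDiffAt ℝ ∞ F p)
    (hi : ∀ᶠ p in 𝓝 z, Function.Injective (spaceDeriv F p)) :
    IsPatchFamilyAt F (patchNormal ε F) z where
  contDiffAt := hF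
  contDiffAt_normal := by
    filter_upwards [hF, hi] with p h1 h2 using contDiffAt_patchNormal h1 h2
  injective := hi
  unit := by
    filter_upwards [hi] with p h
    have h0 := norm_ne_zero_iff.2 (cross_single_ne_zero h)
    rw [patchNormal, inner_smul_left, inner_smul_right, real_inner_self_eq_norm_sq]
    rcases hε with rfl | rfl <;> simp <;> field_simp
  orthogonal := by
    refine Filter.Eventually.of_forall fun p w => ?_
    have h := inner_cross_comp (spaceDeriv F p) (EuclideanSpace.basisFun (Fin m) ℝ).toBasis w
    simp only [OrthonormalBasis.coe_toBasis, EuclideanSpace.basisFun_apply] at h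
    rw [patchNormal, inner_smul_left, h, mul_zero]
  spanning := by
    filter_upwards [hi] with p h u h1 h2
    have h0 := cross_single_ne_zero h
    refine eq_zero_of_inner_cross h0 ?_ fun i => h2 _
    rw [patchNormal, inner_smul_right] at h1
    have h3 : ε * ‖cross (fun i => spaceDeriv F p (EuclideanSpace.single i 1))‖⁻¹ ≠ 0 := by
      refine mul_ne_zero ?_ (inv_ne_zero (norm_ne_zero_iff.2 h0))
      rcases hε with rfl | rfl <;> norm_num
    exact (mul_eq_zero.1 h1).resolve_left h3

theorem eventually_target (x₀ : M) (t : ℝ) :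
    ∀ᶠ p : ℝ × Euc m in 𝓝 (t, extChartAt (𝓡 m) x₀ x₀), p.2 ∈ (extChartAt (𝓡 m) x₀).target :=
  continuous_snd.continuousAt.eventually (target_mem_nhds x₀ (mem_extChartAt_target x₀))

variable [IsManifold (𝓡 m) ∞ M]

theorem contDiffAt_patch {f : ℝ → M → Euc (m + 1)}
    (hf : ContMDiff (𝓘(ℝ, ℝ).prod (𝓡 m)) 𝓘(ℝ, Euc (m + 1)) ∞ (fun p : ℝ × M => f p.1 p.2))
    {x₀ : M} {t : ℝ} {y : Euc m} (hy : y ∈ (extChartAt (𝓡 m) x₀).target) :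
    ContDiffAt ℝ ∞ (patch f x₀) (t, y) := by
  rw [← contMDiffAt_iff_contDiffAt]
  have h1 : ContMDiffAt 𝓘(ℝ, ℝ × Euc m) 𝓘(ℝ, ℝ) ∞ (fun z : ℝ × Euc m => z.1) (t, y) :=
    contDiff_fst.contMDiff.contMDiffAt
  have h2 : ContMDiffAt 𝓘(ℝ, ℝ × Euc m) 𝓘(ℝ, Euc m) ∞ (fun z : ℝ × Euc m => z.2) (t, y) :=
    contDiff_snd.contMDiff.contMDiffAt
  have h3 : ContMDiffAt 𝓘(ℝ, ℝ × Euc m) (𝓡 m) ∞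
      (fun z : ℝ × Euc m => (extChartAt (𝓡 m) x₀).symm z.2) (t, y) :=
    ContMDiffAt.comp (t, y) (contMDiffAt_symm (M := M) (x₀ := x₀) hy) h2
  exact (hf (t, (extChartAt (𝓡 m) x₀).symm y)).comp (t, y) (h1.prodMk h3)

theorem spaceDeriv_patch {f : ℝ → M → Euc (m + 1)}
    (hf : ContMDiff (𝓘(ℝ, ℝ).prod (𝓡 m)) 𝓘(ℝ, Euc (m + 1)) ∞ (fun p : ℝ × M => f p.1 p.2))
    {x₀ : M} {t : ℝ} {y : Euc m} (hy : y ∈ (extChartAt (𝓡 m) x₀).target) :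
    spaceDeriv (patch f x₀) (t, y) =
      (tangentMap m (f t) ((extChartAt (𝓡 m) x₀).symm y)).comp (chartFrame x₀ y) := by
  rw [spaceDeriv_eq_fderiv ((contDiffAt_patch hf hy).differentiableAt (by simp)),
    ← fderiv_comp_symm hy]
  · rfl
  · have h : ContMDiff (𝓡 m) 𝓘(ℝ, Euc (m + 1)) ∞ (f t) :=
      hf.comp (contMDiff_const.prodMk contMDiff_id)
    exact h.mdifferentiableAt (by simp)

theorem chartFrame_injective {x₀ : M} {y : Euc m} (hy : y ∈ (extChartAt (𝓡 m) x₀).target) :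
    Function.Injective (chartFrame x₀ y) :=
  Function.LeftInverse.injective fun v =>
    congrArg (fun T : Euc m →L[ℝ] Euc m => T v) (chartDeriv_comp_chartFrame hy)

theorem chartFrame_surjective {x₀ : M} {y : Euc m} (hy : y ∈ (extChartAt (𝓡 m) x₀).target) :
    Function.Surjective (chartFrame x₀ y) :=
  Function.RightInverse.surjective fun v =>
    congrArg (fun T : Euc m →L[ℝ] Euc m => T v) (chartFrame_comp_chartDeriv hy)

theorem spaceDeriv_patch_injective {f : ℝ → M → Euc (m + 1)}
    (hf : ContMDiff (𝓘(ℝ, ℝ).prod (𝓡 m)) 𝓘(ℝ, Euc (m + 1)) ∞ (fun p : ℝ × M => f p.1 p.2))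
    {x₀ : M} {t : ℝ} {y : Euc m} (hy : y ∈ (extChartAt (𝓡 m) x₀).target) :
    Function.Injective (spaceDeriv (patch f x₀) (t, y)) ↔
      Function.Injective (tangentMap m (f t) ((extChartAt (𝓡 m) x₀).symm y)) := by
  rw [spaceDeriv_patch hf hy, ContinuousLinearMap.coe_comp]
  exact Function.Injective.of_comp_iff' _ ⟨chartFrame_injective hy, chartFrame_surjective hy⟩

theorem isPatchFamilyAt_patch {f : ℝ → M → Euc (m + 1)}
    (hf : ContMDiff (𝓘(ℝ, ℝ).prod (𝓡 m)) 𝓘(ℝ, Euc (m + 1)) ∞ (fun p : ℝ × M => f p.1 p.2))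
    (hi : ∀ t, IsSmoothImmersion (f t)) {ε : ℝ} (hε : ε = 1 ∨ ε = -1) (x₀ : M) (t : ℝ) :
    IsPatchFamilyAt (patch f x₀) (patchNormal ε (patch f x₀)) (t, extChartAt (𝓡 m) x₀ x₀) := by
  refine isPatchFamilyAt_patchNormal hε ?_ ?_
  · filter_upwards [eventually_target x₀ t] with p hp using contDiffAt_patch hf hp
  · filter_upwards [eventually_target x₀ t] with p hp
    exact (spaceDeriv_patch_injective hf hp).2 ((hi p.1).injective _)

/-- Near a point, the unit normal fields of all the immersions in a family are given by the
normalized cross product, with a common sign. -/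
theorem exists_unitNormal_eq_patchNormal (o : ManifoldOrientation m M) {f : ℝ → M → Euc (m + 1)}
    (hf : ContMDiff (𝓘(ℝ, ℝ).prod (𝓡 m)) 𝓘(ℝ, Euc (m + 1)) ∞ (fun p : ℝ × M => f p.1 p.2))
    (hi : ∀ t, IsSmoothImmersion (f t)) (x₀ : M) :
    ∃ ε : ℝ, (ε = 1 ∨ ε = -1) ∧ ∀ᶠ y in 𝓝 (extChartAt (𝓡 m) x₀ x₀),
      y ∈ (extChartAt (𝓡 m) x₀).target ∧ ∀ t,
        unitNormal o (f t) ((extChartAt (𝓡 m) x₀).symm y) =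
          patchNormal ε (patch f x₀) (t, y) := by
  obtain ⟨ε, hε, h⟩ := exists_sign_chartBasis o x₀
  refine ⟨ε, hε, ?_⟩
  filter_upwards [h, target_mem_nhds x₀ (mem_extChartAt_target x₀)] with y hb hy
  refine ⟨hy, fun t => ?_⟩
  obtain ⟨b, hb1, hb2⟩ := hb hy
  have h1 := unitNormal_eq ((hi t).injective _) (chartBasis x₀ hy) hb1 hb2
  simp only [chartBasis_apply] at h1
  rw [h1, patchNormal, spaceDeriv_patch hf hy]
  rfl

/-- `∂ᵢN` in the preferred chart, for the unit normal field. -/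
theorem spaceDeriv_patchNormal {o : ManifoldOrientation m M} {f : ℝ → M → Euc (m + 1)}
    (hf : ContMDiff (𝓘(ℝ, ℝ).prod (𝓡 m)) 𝓘(ℝ, Euc (m + 1)) ∞ (fun p : ℝ × M => f p.1 p.2))
    (hi : ∀ t, IsSmoothImmersion (f t)) {x₀ : M} {ε : ℝ} {y : Euc m}
    (h : ∀ᶠ y' in 𝓝 y, y' ∈ (extChartAt (𝓡 m) x₀).target ∧ ∀ t,
        unitNormal o (f t) ((extChartAt (𝓡 m) x₀).symm y') =
          patchNormal ε (patch f x₀) (t, y')) (t : ℝ) :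
    spaceDeriv (patchNormal ε (patch f x₀)) (t, y) =
      (tangentMap m (unitNormal o (f t)) ((extChartAt (𝓡 m) x₀).symm y)).comp
        (chartFrame x₀ y) := by
  have hy : y ∈ (extChartAt (𝓡 m) x₀).target := h.self_of_nhds.1
  have hN : ContDiffAt ℝ ∞ (patchNormal ε (patch f x₀)) (t, y) :=
    contDiffAt_patchNormal (contDiffAt_patch hf hy)
      ((spaceDeriv_patch_injective hf hy).2 ((hi t).injective _))
  have hN' : ContDiffAt ℝ ∞ (fun y' => patchNormal ε (patch f x₀) (t, y')) y :=
    hN.comp y (contDiff_prodMk_right t).contDiffAt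
  set x := (extChartAt (𝓡 m) x₀).symm y with hx
  have hxs : x ∈ (extChartAt (𝓡 m) x₀).source := (extChartAt (𝓡 m) x₀).map_target hy
  have hφx : extChartAt (𝓡 m) x₀ x = y := (extChartAt (𝓡 m) x₀).right_inv hy
  have hφ : ContMDiffAt (𝓡 m) 𝓘(ℝ, Euc m) ∞ (extChartAt (𝓡 m) x₀) x :=
    contMDiffAt_extChartAt' (by rwa [extChartAt_source] at hxs)
  have hev : unitNormal o (f t) =ᶠ[𝓝 x]
      (fun y' => patchNormal ε (patch f x₀) (t, y')) ∘ extChartAt (𝓡 m) x₀ := by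
    have h1 := hφ.continuousAt.eventually (hφx.symm ▸ h)
    filter_upwards [h1, (isOpen_extChartAt_source (I := 𝓡 m) x₀).mem_nhds hxs] with x' h2 h3
    have h4 := h2.2 t
    rw [(extChartAt (𝓡 m) x₀).left_inv h3] at h4
    exact h4
  -- Differentiability on `M` has to be established before the chain rule: the unit normal is
  -- defined pointwise by choice, and `mfderiv` is zero by default.
  have hmd : MDifferentiableAt (𝓡 m) 𝓘(ℝ, Euc (m + 1)) (unitNormal o (f t)) x := by
    refine MDifferentiableAt.congr_of_eventuallyEq ?_ hev
    refine MDifferentiableAt.comp x ?_ (hφ.mdifferentiableAt (by simp))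
    rw [hφx]
    exact (hN'.differentiableAt (by simp)).mdifferentiableAt
  rw [spaceDeriv_eq_fderiv (hN.differentiableAt (by simp)), ← fderiv_comp_symm hy hmd]
  refine (Filter.EventuallyEq.fderiv_eq ?_).symm
  filter_upwards [h] with y' hy'
  exact hy'.2 t

/-- The Weingarten map in the preferred chart. -/
theorem chartFrame_patchWeingarten {o : ManifoldOrientation m M} {f : ℝ → M → Euc (m + 1)}
    (hf : ContMDiff (𝓘(ℝ, ℝ).prod (𝓡 m)) 𝓘(ℝ, Euc (m + 1)) ∞ (fun p : ℝ × M => f p.1 p.2))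
    (hi : ∀ t, IsSmoothImmersion (f t)) {x₀ : M} {ε : ℝ} {y : Euc m}
    (h : ∀ᶠ y' in 𝓝 y, y' ∈ (extChartAt (𝓡 m) x₀).target ∧ ∀ t,
        unitNormal o (f t) ((extChartAt (𝓡 m) x₀).symm y') =
          patchNormal ε (patch f x₀) (t, y')) (t : ℝ) :
    (chartFrame x₀ y).comp (patchWeingarten (patch f x₀) (patchNormal ε (patch f x₀)) (t, y)) =
      (weingarten o (f t) ((extChartAt (𝓡 m) x₀).symm y)).comp (chartFrame x₀ y) := by
  have hy : y ∈ (extChartAt (𝓡 m) x₀).target := h.self_of_nhds.1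
  set x := (extChartAt (𝓡 m) x₀).symm y with hx
  set A := chartFrame x₀ y with hA
  have hF := spaceDeriv_patch hf (t := t) hy
  have hN := spaceDeriv_patchNormal hf hi h t
  have hiF := (spaceDeriv_patch_injective hf (t := t) hy).2 ((hi t).injective _)
  have hgM : (inducedMetric (f t) x).IsInvertible := isInvertible_gram ((hi t).injective x)
  ext1 v
  apply hgM.injective
  ext w
  obtain ⟨w, rfl⟩ := chartFrame_surjective hy w
  have h1 : ∀ u, inducedMetric (f t) x (A u) (A w) =
      gram (spaceDeriv (patch f x₀) (t, y)) (spaceDeriv (patch f x₀) (t, y)) u w := by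
    intro u
    rw [hF]
    rfl
  have h2 : inducedMetric (f t) x (weingarten o (f t) x (A v)) =
      secondFundamentalForm o (f t) x (A v) := sharp_apply hgM _
  rw [ContinuousLinearMap.comp_apply, ContinuousLinearMap.comp_apply, h1, h2, patchWeingarten,
    ContinuousLinearMap.comp_apply, sharp_apply (isInvertible_gram hiF), hF, hN]
  rfl

/-- The two Weingarten maps are conjugate by the invertible coordinate frame. Points other than the
base point are needed too, since the curvature is differentiated in space. -/
theorem det_patchWeingarten {o : ManifoldOrientation m M} {f : ℝ → M → Euc (m + 1)}
    (hf : ContMDiff (𝓘(ℝ, ℝ).prod (𝓡 m)) 𝓘(ℝ, Euc (m + 1)) ∞ (fun p : ℝ × M => f p.1 p.2))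
    (hi : ∀ t, IsSmoothImmersion (f t)) {x₀ : M} {ε : ℝ} {y : Euc m}
    (h : ∀ᶠ y' in 𝓝 y, y' ∈ (extChartAt (𝓡 m) x₀).target ∧ ∀ t,
        unitNormal o (f t) ((extChartAt (𝓡 m) x₀).symm y') =
          patchNormal ε (patch f x₀) (t, y')) (t : ℝ) :
    LinearMap.det (patchWeingarten (patch f x₀) (patchNormal ε (patch f x₀)) (t, y) :
      Euc m →ₗ[ℝ] Euc m) = gaussCurvature o (f t) ((extChartAt (𝓡 m) x₀).symm y) := by
  have hy : y ∈ (extChartAt (𝓡 m) x₀).target := h.self_of_nhds.1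
  have h1 := congrArg (fun T : Euc m →L[ℝ] Euc m => LinearMap.det (T : Euc m →ₗ[ℝ] Euc m))
    (chartFrame_patchWeingarten hf hi h t)
  simp only [ContinuousLinearMap.toLinearMap_comp, LinearMap.det_comp] at h1
  have h2 : LinearMap.det (chartFrame x₀ y : Euc m →ₗ[ℝ] Euc m) ≠ 0 := by
    have h3 := congrArg (fun T : Euc m →L[ℝ] Euc m => LinearMap.det (T : Euc m →ₗ[ℝ] Euc m))
      (chartFrame_comp_chartDeriv hy)
    simp only [ContinuousLinearMap.toLinearMap_comp, LinearMap.det_comp] at h3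
    exact left_ne_zero_of_mul_eq_one (h3.trans LinearMap.det_id)
  rw [mul_comm] at h1
  exact mul_right_cancel₀ h2 h1

end Transport

/-! ### Variation of the Gauß curvature on the manifold and existence of paths -/

section Variation

variable {m : ℕ} {M : Type*} [TopologicalSpace M] [ChartedSpace (Euc m) M]

theorem differential_eq_fderiv {u : M → ℝ} {x₀ : M}
    (hu : MDifferentiableAt (𝓡 m) 𝓘(ℝ, ℝ) u x₀) (X : Euc m) :
    differential u x₀ X =
      fderiv ℝ (u ∘ (extChartAt (𝓡 m) x₀).symm) (extChartAt (𝓡 m) x₀ x₀) X := by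
  have h := hu.mfderiv
  simp only [writtenInExtChartAt, extChartAt_model_space_eq_id, PartialEquiv.refl_coe,
    Function.id_comp, ModelWithCorners.range_eq_univ, fderivWithin_univ] at h
  rw [differential, h]
  rfl

variable [IsManifold (𝓡 m) ∞ M]

theorem gaussCurvature_eventuallyEq {o : ManifoldOrientation m M} {f : ℝ → M → Euc (m + 1)}
    (hf : ContMDiff (𝓘(ℝ, ℝ).prod (𝓡 m)) 𝓘(ℝ, Euc (m + 1)) ∞ (fun p : ℝ × M => f p.1 p.2))
    (hi : ∀ t, IsSmoothImmersion (f t)) {x₀ : M} {ε : ℝ}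
    (h : ∀ᶠ y' in 𝓝 (extChartAt (𝓡 m) x₀ x₀), y' ∈ (extChartAt (𝓡 m) x₀).target ∧ ∀ t,
        unitNormal o (f t) ((extChartAt (𝓡 m) x₀).symm y') =
          patchNormal ε (patch f x₀) (t, y')) :
    ∀ᶠ x in 𝓝 x₀, ∀ t, gaussCurvature o (f t) x =
      LinearMap.det (patchWeingarten (patch f x₀) (patchNormal ε (patch f x₀))
        (t, extChartAt (𝓡 m) x₀ x) : Euc m →ₗ[ℝ] Euc m) := by
  filter_upwards [(continuousAt_extChartAt (I := 𝓡 m) x₀).eventually h.eventually_nhds,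
    extChartAt_source_mem_nhds (I := 𝓡 m) x₀] with x hx hxs t
  rw [det_patchWeingarten hf hi hx, (extChartAt (𝓡 m) x₀).left_inv hxs]

/-- Near `(t, x₀)` the curvature is a smooth patch expression composed with the chart. The
neighbourhood of `x₀` and the sign `ε` serve all times at once, which gives joint smoothness. -/
theorem contMDiff_gaussCurvature (o : ManifoldOrientation m M) {f : ℝ → M → Euc (m + 1)}
    (hf : ContMDiff (𝓘(ℝ, ℝ).prod (𝓡 m)) 𝓘(ℝ, Euc (m + 1)) ∞ (fun p : ℝ × M => f p.1 p.2))
    (hi : ∀ t, IsSmoothImmersion (f t)) :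
    ContMDiff (𝓘(ℝ, ℝ).prod (𝓡 m)) 𝓘(ℝ, ℝ) ∞
      (fun p : ℝ × M => gaussCurvature o (f p.1) p.2) := by
  rintro ⟨t, x₀⟩
  obtain ⟨ε, hε, h⟩ := exists_unitNormal_eq_patchNormal o hf hi x₀
  have hP := isPatchFamilyAt_patch hf hi hε x₀ t
  have hK : ContDiffAt ℝ ∞ (fun z => LinearMap.det (patchWeingarten (patch f x₀)
      (patchNormal ε (patch f x₀)) z : Euc m →ₗ[ℝ] Euc m)) (t, extChartAt (𝓡 m) x₀ x₀) :=
    contDiff_det.contDiffAt.comp _ (contDiffAt_patchWeingarten hP.contDiffAt.self_of_nhds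
      hP.contDiffAt_normal.self_of_nhds hP.injective.self_of_nhds)
  have hφ : ContMDiffAt (𝓘(ℝ, ℝ).prod (𝓡 m)) 𝓘(ℝ, ℝ × Euc m) ∞
      (fun p : ℝ × M => (p.1, extChartAt (𝓡 m) x₀ p.2)) (t, x₀) := by
    have h1 : ContMDiffAt (𝓘(ℝ, ℝ).prod (𝓡 m)) 𝓘(ℝ, Euc m) ∞
        (fun p : ℝ × M => extChartAt (𝓡 m) x₀ p.2) (t, x₀) :=
      ContMDiffAt.comp (t, x₀) (contMDiffAt_extChartAt (I := 𝓡 m) (x := x₀)) contMDiffAt_snd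
    exact contMDiffAt_fst.prodMk_space h1
  have hcomp : ContMDiffAt (𝓘(ℝ, ℝ).prod (𝓡 m)) 𝓘(ℝ, ℝ) ∞
      ((fun z => LinearMap.det (patchWeingarten (patch f x₀)
        (patchNormal ε (patch f x₀)) z : Euc m →ₗ[ℝ] Euc m)) ∘
          fun p : ℝ × M => (p.1, extChartAt (𝓡 m) x₀ p.2)) (t, x₀) :=
    ContMDiffAt.comp (t, x₀) hK.contMDiffAt hφ
  refine hcomp.congr_of_eventuallyEq ?_
  filter_upwards [continuous_snd.continuousAt.eventually (gaussCurvature_eventuallyEq hf hi h)]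
    with p hp using hp p.1

/-- The patch formula in the preferred chart at `x`. Undifferentiated quantities agree at the base
point because the coordinate frame is the identity there; differentiated ones must agree near it. -/
theorem IsVariation.hasDerivAt_gaussCurvature (o : ManifoldOrientation m M)
    {f₀ h : M → Euc (m + 1)} {f : ℝ → M → Euc (m + 1)} (hv : IsVariation f₀ h f) (x : M) :
    HasDerivAt (fun t => gaussCurvature o (f t) x)
      (meanCurvature o f₀ x * gaussCurvature o f₀ x * normalPart o f₀ h x +
        tensorInner (inducedMetric f₀ x)
          ((inducedMetric f₀ x).comp (classicalAdjoint (weingarten o f₀ x)))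
          (hessian (inducedMetric f₀) (normalPart o f₀ h) x) +
        differential (gaussCurvature o f₀) x (tangentialPart f₀ h x)) 0 := by
  have hf := hv.contMDiff
  have hi := hv.immersion
  obtain rfl := hv.initial
  obtain ⟨ε, hε, hn⟩ := exists_unitNormal_eq_patchNormal o hf hi x
  have hP := isPatchFamilyAt_patch hf hi hε x 0
  set φ := extChartAt (𝓡 m) x with hφ
  set F := patch f x with hF
  set N := patchNormal ε F with hN
  have hy : φ x ∈ φ.target := mem_extChartAt_target x
  have hφx : φ.symm (φ x) = x := extChartAt_to_inv x
  have hcomp_id : ∀ T : Euc m →L[ℝ] Euc (m + 1),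
      T.comp (chartFrame x (φ x)) = T := fun T => by
    rw [hφ, chartFrame_self, ContinuousLinearMap.comp_id]
  have hdF : spaceDeriv F (0, φ x) = tangentMap m (f 0) x := by
    rw [hF, spaceDeriv_patch hf hy, hcomp_id, hφx]
  have hg : gram (spaceDeriv F (0, φ x)) (spaceDeriv F (0, φ x)) = inducedMetric (f 0) x := by
    rw [hdF]
    rfl
  have hL : patchWeingarten F N (0, φ x) = weingarten o (f 0) x := by
    have h1 := chartFrame_patchWeingarten hf hi hn 0
    rw [hφ, chartFrame_self, ContinuousLinearMap.comp_id, ContinuousLinearMap.id_comp] at h1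
    rw [hF, hN, h1, ← hφ, hφx]
  have hvel : ∀ y ∈ φ.target, fderiv ℝ F (0, y) (1, 0) = h (φ.symm y) := by
    intro y hy
    have h1 := ((contDiffAt_patch hf (t := 0) hy).differentiableAt
      (by simp)).hasFDerivAt.comp_hasDerivAt (0 : ℝ) (f := fun t : ℝ => (t, y)) (f' := (1, 0))
      ((hasDerivAt_id (0 : ℝ)).prodMk (hasDerivAt_const _ _))
    exact h1.unique (hv.velocity (φ.symm y))
  -- Equality of germs, because the Hessian takes two derivatives of the normal part.
  have hnormal : normalPart o (f 0) h ∘ φ.symm =ᶠ[𝓝 (φ x)]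
      fun y => ⟪fderiv ℝ F (0, y) (1, 0), N (0, y)⟫ := by
    filter_upwards [hn] with y hy
    rw [hvel y hy.1, ← hy.2 0]
    rfl
  have hmetric : metricInChart (inducedMetric (f 0)) x =ᶠ[𝓝 (φ x)]
      fun y => gram (spaceDeriv F (0, y)) (spaceDeriv F (0, y)) := by
    filter_upwards [hn] with y hy
    rw [hF, spaceDeriv_patch hf hy.1]
    rfl
  have hH : ∀ v w, hessian (inducedMetric (f 0)) (normalPart o (f 0) h) x v w =
      fderiv ℝ (fderiv ℝ fun y' => ⟪fderiv ℝ F (0, y') (1, 0), N (0, y')⟫) (φ x) v w -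
      fderiv ℝ (fun y' => ⟪fderiv ℝ F (0, y') (1, 0), N (0, y')⟫) (φ x)
        (sharp (gram (spaceDeriv F (0, φ x)) (spaceDeriv F (0, φ x)))
          (christoffelCombination (fderiv ℝ
            (fun y' => gram (spaceDeriv F (0, y')) (spaceDeriv F (0, y'))) (φ x)) v w)) := by
    intro v w
    rw [hessian_apply, christoffelFirst, ← hφ, hnormal.fderiv.fderiv_eq, hnormal.fderiv_eq,
      hmetric.fderiv_eq, hg]
  have key := hP.hasDerivAt_det hH
  have hgauss : ∀ t, LinearMap.det (patchWeingarten F N (t, φ x) : Euc m →ₗ[ℝ] Euc m) =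
      gaussCurvature o (f t) x := fun t => by
    rw [hF, hN, det_patchWeingarten hf hi hn, ← hφ, hφx]
  have hdiff : MDifferentiableAt (𝓡 m) 𝓘(ℝ, ℝ) (gaussCurvature o (f 0)) x :=
    ((contMDiff_gaussCurvature o hf hi).comp
      (contMDiff_const.prodMk contMDiff_id : ContMDiff (𝓡 m) (𝓘(ℝ, ℝ).prod (𝓡 m)) ∞
        fun x : M => ((0 : ℝ), x))).mdifferentiableAt (by simp)
  have hdet : (fun y' => LinearMap.det (patchWeingarten F N (0, y') : Euc m →ₗ[ℝ] Euc m))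
      =ᶠ[𝓝 (φ x)] gaussCurvature o (f 0) ∘ φ.symm := by
    filter_upwards [hn.eventually_nhds] with y hy
    exact det_patchWeingarten hf hi hy 0
  have hX : (innerSL ℝ (fderiv ℝ F (0, φ x) (1, 0))).comp (spaceDeriv F (0, φ x)) =
      (innerSL ℝ (h x)).comp (tangentMap m (f 0) x) := by
    rw [hvel _ hy, hφx, hdF]
  have hA : ⟪fderiv ℝ F (0, φ x) (1, 0), N (0, φ x)⟫ = normalPart o (f 0) h x := by
    have h1 := hnormal.self_of_nhds
    rw [Function.comp_apply, hφx] at h1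
    exact h1.symm
  simp only [hgauss] at key
  rw [hg, hL, hA, hX, hdet.fderiv_eq, ← differential_eq_fderiv hdiff] at key
  exact key

/-- A smooth path of immersions with prescribed velocity. -/
theorem exists_isVariation [CompactSpace M] {f₀ h : M → Euc (m + 1)} (hf₀ : IsSmoothImmersion f₀)
    (hh : ContMDiff (𝓡 m) 𝓘(ℝ, Euc (m + 1)) ∞ h) : ∃ f, IsVariation f₀ h f := by
  have hsm : ∀ ρ : ℝ → ℝ, ContDiff ℝ ∞ ρ →
      ContMDiff (𝓘(ℝ, ℝ).prod (𝓡 m)) 𝓘(ℝ, Euc (m + 1)) ∞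
        (fun p : ℝ × M => f₀ p.2 + ρ p.1 • h p.2) := fun ρ hρ =>
    (hf₀.contMDiff.comp contMDiff_snd).add
      ((hρ.contMDiff.comp contMDiff_fst).smul (hh.comp contMDiff_snd))
  set f : ℝ → M → Euc (m + 1) := fun s x => f₀ x + s • h x with hf
  have hfs : ContMDiff (𝓘(ℝ, ℝ).prod (𝓡 m)) 𝓘(ℝ, Euc (m + 1)) ∞
      (fun p : ℝ × M => f p.1 p.2) := hsm id contDiff_id
  -- the immersion condition is open
  have hopen : ∀ x₀ : M, ∀ᶠ p : ℝ × M in 𝓝 (0, x₀),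
      Function.Injective (tangentMap m (f p.1) p.2) := by
    intro x₀
    have hy := mem_extChartAt_target (I := 𝓡 m) x₀
    have h1 : Function.Injective (spaceDeriv (patch f x₀) (0, extChartAt (𝓡 m) x₀ x₀)) := by
      rw [spaceDeriv_patch_injective hfs hy]
      have : f 0 = f₀ := by funext x; simp [hf]
      rw [this]
      exact hf₀.injective _
    have h2 : ContinuousAt (spaceDeriv (patch f x₀)) (0, extChartAt (𝓡 m) x₀ x₀) :=
      (contDiffAt_spaceDeriv (contDiffAt_patch hfs hy)).continuousAt
    have h3 := h2.eventually (ContinuousLinearMap.isOpen_injective.mem_nhds h1)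
    have h4 : ContinuousAt (fun p : ℝ × M => (p.1, extChartAt (𝓡 m) x₀ p.2)) (0, x₀) :=
      continuousAt_fst.prodMk
        (ContinuousAt.comp (continuousAt_extChartAt (I := 𝓡 m) x₀) continuousAt_snd)
    filter_upwards [h4.eventually h3, continuousAt_snd.eventually
      (extChartAt_source_mem_nhds (I := 𝓡 m) x₀)] with p hp hps
    have h5 := (spaceDeriv_patch_injective hfs ((extChartAt (𝓡 m) x₀).map_source hps)).1 hp
    rwa [(extChartAt (𝓡 m) x₀).left_inv hps] at h5
  have hunif : ∀ᶠ s : ℝ in 𝓝 0, ∀ x ∈ (Set.univ : Set M),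
      Function.Injective (tangentMap m (f s) x) :=
    isCompact_univ.eventually_forall_of_forall_eventually fun x _ => hopen x
  obtain ⟨δ, hδ, hball⟩ := Metric.eventually_nhds_iff.1 hunif
  -- Bounded by `δ / 2 < δ`, so `f₀ + ρ(t) h` is an immersion for every real `t`; the frequency `2 /
  -- δ` makes `ρ'(0) = 1`.
  let ρ : ℝ → ℝ := fun t => δ / 2 * Real.sin (2 / δ * t)
  have hρ : ContDiff ℝ ∞ ρ :=
    contDiff_const.mul (Real.contDiff_sin.comp (contDiff_const.mul contDiff_id))
  have hρlt : ∀ t, dist (ρ t) 0 < δ := fun t => by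
    rw [Real.dist_eq, sub_zero, abs_mul, abs_of_pos (half_pos hδ)]
    have := Real.abs_sin_le_one (2 / δ * t)
    nlinarith
  have hρ' : HasDerivAt ρ 1 0 := by
    have h1 : HasDerivAt (fun t : ℝ => 2 / δ * t) (2 / δ) 0 := by
      simpa using (hasDerivAt_id (0 : ℝ)).const_mul (2 / δ)
    have h2 := (h1.sin).const_mul (δ / 2)
    refine h2.congr_deriv ?_
    simp
    field_simp
  refine ⟨fun t => f (ρ t), hsm ρ hρ, fun t => ⟨?_, fun x => hball (hρlt t) x trivial⟩, ?_, ?_⟩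
  · exact (hsm (fun _ => ρ t) contDiff_const).comp (contMDiff_const.prodMk contMDiff_id :
      ContMDiff (𝓡 m) (𝓘(ℝ, ℝ).prod (𝓡 m)) ∞ fun x : M => ((0 : ℝ), x))
  · funext x
    simp [hf, ρ]
  · intro x
    exact ((hρ'.smul_const (h x)).const_add (f₀ x)).congr_deriv (one_smul ℝ (h x))

end Variation

end

end HypersurfaceVariation

theorem mainTheorem1 (m : ℕ) (M : Type*) [TopologicalSpace M] [T2Space M] [CompactSpace M]
    [ConnectedSpace M] [ChartedSpace (HypersurfaceVariation.Euc m) M] [IsManifold (𝓡 m) ∞ M]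
    (o : HypersurfaceVariation.ManifoldOrientation m M)
    (f₀ h : M → HypersurfaceVariation.Euc (m + 1))
    (hf₀ : HypersurfaceVariation.IsSmoothImmersion f₀)
    (hh : ContMDiff (𝓡 m) 𝓘(ℝ, HypersurfaceVariation.Euc (m + 1)) ∞ h) :
    (∃ f, HypersurfaceVariation.IsVariation f₀ h f) ∧
    ∀ f, HypersurfaceVariation.IsVariation f₀ h f →
      ContMDiff (𝓘(ℝ, ℝ).prod (𝓡 m)) 𝓘(ℝ, ℝ) ∞
        (fun p : ℝ × M => HypersurfaceVariation.gaussCurvature o (f p.1) p.2) ∧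
      ∀ x : M, HasDerivAt (fun t => HypersurfaceVariation.gaussCurvature o (f t) x)
        (HypersurfaceVariation.meanCurvature o f₀ x * HypersurfaceVariation.gaussCurvature o f₀ x *
            HypersurfaceVariation.normalPart o f₀ h x +
          HypersurfaceVariation.tensorInner (HypersurfaceVariation.inducedMetric f₀ x)
            ((HypersurfaceVariation.inducedMetric f₀ x).comp
              (HypersurfaceVariation.classicalAdjoint (HypersurfaceVariation.weingarten o f₀ x)))
            (HypersurfaceVariation.hessian (HypersurfaceVariation.inducedMetric f₀)
              (HypersurfaceVariation.normalPart o f₀ h) x) +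
          HypersurfaceVariation.differential (HypersurfaceVariation.gaussCurvature o f₀) x
            (HypersurfaceVariation.tangentialPart f₀ h x)) 0 :=
  ⟨HypersurfaceVariation.exists_isVariation hf₀ hh, fun _ hv =>
    ⟨HypersurfaceVariation.contMDiff_gaussCurvature o hv.contMDiff hv.immersion,
      hv.hasDerivAt_gaussCurvature o⟩⟩
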